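/- \textbf{Theorem.} Let $D\subset\mathbb{C}$ be a nonempty connected open set (for instance $\mathbb{C}$ or $\mathbb{C}\setminus\{0\}$), and let $q\in\mathbb{C}$ with $q\neq 0$, $q^2\neq 1$. The $N=3$ Cremmer--Gervais $R$-matrix $R(z,q)\in\mathrm{End}(\mathbb{C}^3\otimes\mathbb{C}^3)$ is given by $R(z,q)(e_k\otimes e_l)=\sum_{i,j=0}^{2}[R(z,q)]^{ij}_{kl}\,e_i\otimes e_j$, where $$[R(z,q)]^{ij}_{kl}=\begin{cases}\dfrac{qz^{-1}-q^{-1}z}{(q-q^{-1})(z-z^{-1})}, & i=j=k=l,\\[2mm] -\dfrac{q^{\mathrm{sgn}(k-l)}}{q-q^{-1}}, & i=k\neq j=l,\\[2mm] \dfrac{z^{\mathrm{sgn}(l-k)}}{z-z^{-1}}, & l=i\neq k=j,\\[2mm] \mathrm{sgn}(l-k), & \min(k,l)<i<\max(k,l),\ i+j=k+l,\\ 0, & \text{otherwise.}\end{cases}$$ Put $R_{12}=R$ and $R_{21}=PR_{12}P$ with $P(x\otimes y)=y\otimes x$; for a matrix-valued function $K$ put $K_1=K\otimes\mathrm{Id}$,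 $K_2=\mathrm{Id}\otimes K$. Let $\mathcal{K}_q$ be the set of $3\times3$ matrices $K(z)$ of meromorphic functions on $D$ which are not identically zero and satisfy the reflection equation $$R_{12}(z_1/z_2,q)K_1(z_1)R_{21}(z_1z_2,q)K_2(z_2)=K_2(z_2)R_{12}(z_1z_2,q)K_1(z_1)R_{21}(z_1/z_2,q)$$ as an identity of meromorphic functions of $z_1,z_2\in D$. Two such matrices are identified if they coincide up to an overall factor, i.e. up to multiplication by a scalar meromorphic function on $D$ that is not identically zero. Then, with this identification, $$\mathcal{K}_q=\mathcal{B}_{\mathrm{I}}\cup\mathcal{B}_{\mathrm{II}},$$ where $\mathcal{B}_{\mathrm{I}}$ and $\mathcal{B}_{\mathrm{II}}$, which do not depend on $q$, are as follows; in particular $\mathcal{K}_q$ is independent of $q$. $\mathcal{B}_{\mathrm{I}}$ consists of the matrices $$K_{\mathrm{I}}(z,\mathcal{Q}_{\mathrm{I}})=\begin{pmatrix}\bar a_3+(a_4-a_3)z^2-\bar a_4z^4 & a_0(z^4-1) & a_1z^2(z^4-1)\\ (\bar a_2+\bar a_0z^2)(z^4-1) & (a_4-a_3)z^2-(\bar a_4-\bar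 a_3)z^4 & (a_0+a_2z^2)(z^4-1)\\ \bar a_1(z^4-1) & \bar a_0z^2(z^4-1) & a_4z^2-(\bar a_4-\bar a_3)z^4-a_3z^6\end{pmatrix}$$ with $\mathcal{Q}_{\mathrm{I}}=(a_0,\dots,a_4,\bar a_0,\dots,\bar a_4)$ in the variety $\mathcal{V}_{\mathrm{I}}\subset\mathbb{P}^9(\mathbb{C})$ cut out by the 14 quadrics (the $\bar a_j$ are independent coordinates, not complex conjugates) $$\begin{gathered}a_0\bar a_0=a_1\bar a_1,\quad a_2\bar a_2=a_3\bar a_3,\quad a_0^2=a_1a_4,\quad \bar a_0^2=\bar a_1\bar a_4,\quad a_1\bar a_0=a_0\bar a_4,\\ \bar a_1a_0=\bar a_0a_4,\quad a_0a_3=a_1\bar a_2,\quad \bar a_0\bar a_3=\bar a_1a_2,\quad a_0a_2=\bar a_3a_1,\quad \bar a_0\bar a_2=a_3\bar a_1,\\ a_2\bar a_0=\bar a_3\bar a_4,\quad \bar a_2a_0=a_3a_4,\quad a_2a_4=a_0\bar a_3,\quad \bar a_2\bar a_4=\bar a_0a_3.\end{gathered}$$ $\mathcal{B}_{\mathrm{II}}$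 consists of the matrices $$K_{\mathrm{II}}(z,\mathcal{Q}_{\mathrm{II}})=\begin{pmatrix}b_3-b_4+bz^2 & 0 & b_0(z^4-1)\\ -b_5(z^4-1) & -b_4+bz^2+b_3z^4 & b_2(z^4-1)\\ b_1(z^4-1) & 0 & bz^2+(b_3-b_4)z^4\end{pmatrix}$$ with $\mathcal{Q}_{\mathrm{II}}=(b,b_0,\dots,b_5)$ in the variety $\mathcal{V}_{\mathrm{II}}\subset\mathbb{P}^6(\mathbb{C})$ cut out by the 3 quadrics $b_0b_1=b_3b_4$, $b_1b_2=b_4b_5$, $b_2b_3=b_5b_0$. -/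

import Mathlib

open Filter
open scoped Kronecker LinearAlgebra.Projectivization

namespace CremmerGervais

/-- Complex `3 × 3` matrices, i.e. `End(ℂ³)` in the basis `e₀, e₁, e₂`. -/
abbrev Mat3 : Type := Matrix (Fin 3) (Fin 3) ℂ

/-- Matrices of endomorphisms of `ℂ³ ⊗ ℂ³` in the basis `eᵢ ⊗ eⱼ`. -/
abbrev Mat9 : Type := Matrix (Fin 3 × Fin 3) (Fin 3 × Fin 3) ℂ

/-- `sgn (k - l)` for indices `k, l ∈ {0, 1, 2}`. -/
def sgn (k l : Fin 3) : ℤ := Int.sign ((k : ℤ) - (l : ℤ))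

/-- The entry `[R(z, q)]^{ij}_{kl}` of the `N = 3` Cremmer-Gervais `R`-matrix. -/
noncomputable def rEntry (z q : ℂ) (i j k l : Fin 3) : ℂ :=
  if i = j ∧ j = k ∧ k = l then
    (q * z⁻¹ - q⁻¹ * z) / ((q - q⁻¹) * (z - z⁻¹))
  else if i = k ∧ j = l then
    - q ^ sgn k l / (q - q⁻¹)
  else if l = i ∧ k = j then
    z ^ sgn l k / (z - z⁻¹)
  else if min k l < i ∧ i < max k l ∧ (i : ℕ) + (j : ℕ) = (k : ℕ) + (l : ℕ) then
    ((sgn l k : ℤ) : ℂ)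
  else 0

/-- The `R`-matrix `R₁₂(z, q)`: `R (e_k ⊗ e_l) = ∑ e_i ⊗ e_j [R(z, q)]^{ij}_{kl}`. -/
noncomputable def R12 (z q : ℂ) : Mat9 :=
  Matrix.of fun r c => rEntry z q r.1 r.2 c.1 c.2

/-- `R₂₁ = P R₁₂ P`, where `P (x ⊗ y) = y ⊗ x`. -/
noncomputable def R21 (z q : ℂ) : Mat9 :=
  (R12 z q).submatrix Prod.swap Prod.swap

/-- `f` and `g` agree on `D` as meromorphic functions: they agree at all points of `D`
outside a set without accumulation points in `D`. -/
def MeroEq {E : Type*} (D : Set ℂ) (f g : ℂ → E) : Prop :=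
  ∀ᶠ z in codiscreteWithin D, f z = g z

/-- The matrices whose nine entries are meromorphic on `D`. -/
def meroMatrices (D : Set ℂ) : Set (ℂ → Mat3) :=
  {K | ∀ i j, MeromorphicOn (fun z => K z i j) D}

/-- The reflection equation, as an identity of meromorphic functions of `z₁, z₂ ∈ D`. -/
def ReflectionEquation (q : ℂ) (D : Set ℂ) (K : ℂ → Mat3) : Prop :=
  ∀ᶠ z₁ in codiscreteWithin D, ∀ᶠ z₂ in codiscreteWithin D,
    R12 (z₁ / z₂) q * (K z₁ ⊗ₖ (1 : Mat3)) * R21 (z₁ * z₂) q * ((1 : Mat3) ⊗ₖ K z₂) =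
      ((1 : Mat3) ⊗ₖ K z₂) * R12 (z₁ * z₂) q * (K z₁ ⊗ₖ (1 : Mat3)) * R21 (z₁ / z₂) q

/-- The solution space: meromorphic solutions that are not identically zero. -/
def solutionSpace (q : ℂ) (D : Set ℂ) : Set (ℂ → Mat3) :=
  {K | K ∈ meroMatrices D ∧ ¬ MeroEq D K 0 ∧ ReflectionEquation q D K}

/-- `K` and `L` coincide up to an overall factor: `K = f L` for a meromorphic function `f`
that is not identically zero. -/
def EqUpToFactor (D : Set ℂ) (K L : ℂ → Mat3) : Prop :=
  ∃ f : ℂ → ℂ, MeromorphicOn f D ∧ ¬ MeroEq D f 0 ∧ MeroEq D K (fun z => f z • L z)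

/-- Homogeneous coordinates `(a, ā)` on `ℙ⁹`. -/
abbrev CoordI : Type := (Fin 5 → ℂ) × (Fin 5 → ℂ)

/-- Homogeneous coordinates `(b, (b₀, …, b₅))` on `ℙ⁶`. -/
abbrev CoordII : Type := ℂ × (Fin 6 → ℂ)

/-- The 14 quadratic relations in `a = v.1` and `ā = v.2`. -/
def RelI (v : CoordI) : Prop :=
  v.1 0 * v.2 0 - v.1 1 * v.2 1 = 0 ∧
  v.1 2 * v.2 2 - v.1 3 * v.2 3 = 0 ∧
  v.1 0 ^ 2 - v.1 1 * v.1 4 = 0 ∧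
  v.2 0 ^ 2 - v.2 1 * v.2 4 = 0 ∧
  v.1 1 * v.2 0 - v.1 0 * v.2 4 = 0 ∧
  v.2 1 * v.1 0 - v.2 0 * v.1 4 = 0 ∧
  v.1 0 * v.1 3 - v.1 1 * v.2 2 = 0 ∧
  v.2 0 * v.2 3 - v.2 1 * v.1 2 = 0 ∧
  v.1 0 * v.1 2 - v.2 3 * v.1 1 = 0 ∧
  v.2 0 * v.2 2 - v.1 3 * v.2 1 = 0 ∧
  v.1 2 * v.2 0 - v.2 3 * v.2 4 = 0 ∧
  v.2 2 * v.1 0 - v.1 3 * v.1 4 = 0 ∧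
  v.1 2 * v.1 4 - v.1 0 * v.2 3 = 0 ∧
  v.2 2 * v.2 4 - v.2 0 * v.1 3 = 0

/-- The 3 quadratic relations in `b₀, …, b₅`. -/
def RelII (v : CoordII) : Prop :=
  v.2 0 * v.2 1 - v.2 3 * v.2 4 = 0 ∧
  v.2 1 * v.2 2 - v.2 4 * v.2 5 = 0 ∧
  v.2 2 * v.2 3 - v.2 5 * v.2 0 = 0

/-- The variety `V_I ⊂ ℙ⁹`. The relations are homogeneous, so the choice of the representative
does not matter (`mk_mem_varietyI`). -/
def varietyI : Set (ℙ ℂ CoordI) := {Q | RelI Q.rep}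

/-- The variety `V_II ⊂ ℙ⁶`; see `mk_mem_varietyII`. -/
def varietyII : Set (ℙ ℂ CoordII) := {Q | RelII Q.rep}

/-- The matrix `K_I(z, Q)` for the coordinates `v = (a, ā)` of `Q`. -/
def matrixI (v : CoordI) (z : ℂ) : Mat3 :=
  let a := v.1
  let a' := v.2
  !![a' 3 + (a 4 - a 3) * z ^ 2 - a' 4 * z ^ 4, a 0 * (z ^ 4 - 1), a 1 * z ^ 2 * (z ^ 4 - 1);
     (a' 2 + a' 0 * z ^ 2) * (z ^ 4 - 1), (a 4 - a 3) * z ^ 2 - (a' 4 - a' 3) * z ^ 4,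
       (a 0 + a 2 * z ^ 2) * (z ^ 4 - 1);
     a' 1 * (z ^ 4 - 1), a' 0 * z ^ 2 * (z ^ 4 - 1),
       a 4 * z ^ 2 - (a' 4 - a' 3) * z ^ 4 - a 3 * z ^ 6]

/-- The matrix `K_II(z, Q)` for the coordinates `v = (b, (b₀, …, b₅))` of `Q`. -/
def matrixII (v : CoordII) (z : ℂ) : Mat3 :=
  let b := v.1
  let c := v.2
  !![c 3 - c 4 + b * z ^ 2, 0, c 0 * (z ^ 4 - 1);
     - c 5 * (z ^ 4 - 1), - c 4 + b * z ^ 2 + c 3 * z ^ 4, c 2 * (z ^ 4 - 1);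
     c 1 * (z ^ 4 - 1), 0, b * z ^ 2 + (c 3 - c 4) * z ^ 4]

/-- The space `B_I` of the matrices `K_I(z, Q)`, `Q ∈ V_I`, up to an overall factor. -/
def spaceI (D : Set ℂ) : Set (ℂ → Mat3) :=
  {K | K ∈ meroMatrices D ∧ ∃ Q ∈ varietyI, EqUpToFactor D K (matrixI Q.rep)}

/-- The space `B_II` of the matrices `K_II(z, Q)`, `Q ∈ V_II`, up to an overall factor. -/
def spaceII (D : Set ℂ) : Set (ℂ → Mat3) :=
  {K | K ∈ meroMatrices D ∧ ∃ Q ∈ varietyII, EqUpToFactor D K (matrixII Q.rep)}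

/-! Independence of the choice of homogeneous coordinates. -/

theorem RelI.smul {v : CoordI} (h : RelI v) (c : ℂ) : RelI (c • v) := by
  simp only [RelI, Prod.smul_fst, Prod.smul_snd, Pi.smul_apply, smul_eq_mul] at h ⊢
  obtain ⟨h1, h2, h3, h4, h5, h6, h7, h8, h9, h10, h11, h12, h13, h14⟩ := h
  refine ⟨?_, ?_, ?_, ?_, ?_, ?_, ?_, ?_, ?_, ?_, ?_, ?_, ?_, ?_⟩
  · linear_combination c ^ 2 * h1
  · linear_combination c ^ 2 * h2
  · linear_combination c ^ 2 * h3
  · linear_combination c ^ 2 * h4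
  · linear_combination c ^ 2 * h5
  · linear_combination c ^ 2 * h6
  · linear_combination c ^ 2 * h7
  · linear_combination c ^ 2 * h8
  · linear_combination c ^ 2 * h9
  · linear_combination c ^ 2 * h10
  · linear_combination c ^ 2 * h11
  · linear_combination c ^ 2 * h12
  · linear_combination c ^ 2 * h13
  · linear_combination c ^ 2 * h14

theorem RelII.smul {v : CoordII} (h : RelII v) (c : ℂ) : RelII (c • v) := by
  simp only [RelII, Prod.smul_snd, Pi.smul_apply, smul_eq_mul] at h ⊢
  obtain ⟨h1, h2, h3⟩ := h
  refine ⟨?_, ?_, ?_⟩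
  · linear_combination c ^ 2 * h1
  · linear_combination c ^ 2 * h2
  · linear_combination c ^ 2 * h3

theorem mk_mem_varietyI (v : CoordI) (hv : v ≠ 0) :
    Projectivization.mk ℂ v hv ∈ varietyI ↔ RelI v := by
  obtain ⟨c, hc⟩ := Projectivization.exists_smul_eq_mk_rep ℂ v hv
  have hc' : (c : ℂ) • v = (Projectivization.mk ℂ v hv).rep := hc
  change RelI (Projectivization.mk ℂ v hv).rep ↔ _
  rw [← hc']
  refine ⟨fun h => ?_, fun h => h.smul _⟩
  have := h.smul ((c : ℂ)⁻¹)
  rwa [smul_smul, inv_mul_cancel₀ c.ne_zero, one_smul] at this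

theorem mk_mem_varietyII (v : CoordII) (hv : v ≠ 0) :
    Projectivization.mk ℂ v hv ∈ varietyII ↔ RelII v := by
  obtain ⟨c, hc⟩ := Projectivization.exists_smul_eq_mk_rep ℂ v hv
  have hc' : (c : ℂ) • v = (Projectivization.mk ℂ v hv).rep := hc
  change RelII (Projectivization.mk ℂ v hv).rep ↔ _
  rw [← hc']
  refine ⟨fun h => ?_, fun h => h.smul _⟩
  have := h.smul ((c : ℂ)⁻¹)
  rwa [smul_smul, inv_mul_cancel₀ c.ne_zero, one_smul] at this

theorem matrixI_smul (c : ℂ) (v : CoordI) (z : ℂ) : matrixI (c • v) z = c • matrixI v z := by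
  ext i j
  fin_cases i <;> fin_cases j <;> simp [matrixI] <;> ring

theorem matrixII_smul (c : ℂ) (v : CoordII) (z : ℂ) : matrixII (c • v) z = c • matrixII v z := by
  ext i j
  fin_cases i <;> fin_cases j <;> simp [matrixII] <;> ring

end CremmerGervais

/-! Put X = z₁², Y = z₂², t = 1/(q² - 1). After clearing denominators the reflection equation is
polynomial in X, Y, t. In the coordinates p, s, r, P, S, R, u, w, f of a 3 × 3 matrix it is
equivalent, at generic points, to 36 bilinear relations `Exchange`, one for each pair of
coordinates, and t does not occur in them. This is the source of the independence of q; it rests on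
`Exchange.polyReflection` and `exchange_of_polyReflection`, which needs t ≠ 0 and 1 + t ≠ 0, i.e. q
finite and nonzero.

Many of the relations say that a coordinate ratio takes the same value at z₁ and z₂, hence is
constant. Fix a generic z₁ and let z₂ vary. By the identity theorem on the connected set D, each
coordinate is generically zero or generically nonzero. If s or S is nonzero, its commutators with
the other coordinates except f force these eight to be proportional to constants, and the relations
involving f determine f as a polynomial divided by X² - 1: this is K_I. If s = S = 0, a nonzero p or
P makes p, r, u, XP, XR, Xw proportional to constants, and this is K_II. If p = P = 0 as well, a
nonzero u or w leads back to K_I; if u = w = 0 too, then r, R or the scalar case leads to K_II. In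
each case the remaining relations, evaluated at a pair with X ≠ Y, are nonzero multiples of the
defining quadrics (`exists_coordsI`, `exists_coordsII`).

Conversely, substituting either family into `Exchange` produces multiples of the quadrics
(`exchange_coordsI`, `exchange_coordsII`), and a nonzero coordinate vector never gives the zero
matrix function. -/

namespace CremmerGervais

/-! ### Coordinates on `3 × 3` matrices -/

/-- Coordinates on `3 × 3` matrices (depending on `X = z ^ 2`) in which the reflection equation
becomes a system of deformed commutation relations. -/
structure Coords where
  (p s r P S R u w f : ℂ)

/-- The matrix with the given coordinates at `X = z ^ 2`. -/
def Coords.toMatrix (X : ℂ) (a : Coords) : Mat3 :=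
  !![a.f + X * a.w - a.u, a.S, X * a.P;
     a.r + X * a.s, a.f + X * a.w, a.S + X * a.R;
     a.p, X * a.s, a.f]

/-- The coordinates of a matrix at `X = z ^ 2`. -/
noncomputable def coords (X : ℂ) (K : Mat3) : Coords where
  p := K 2 0
  s := K 2 1 / X
  r := K 1 0 - K 2 1
  P := K 0 2 / X
  S := K 0 1
  R := (K 1 2 - K 0 1) / X
  u := K 1 1 - K 0 0
  w := (K 1 1 - K 2 2) / X
  f := K 2 2

theorem toMatrix_coords {X : ℂ} (hX : X ≠ 0) (K : Mat3) : (coords X K).toMatrix X = K := by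
  ext i j
  fin_cases i <;> fin_cases j <;> simp [coords, Coords.toMatrix] <;> field_simp <;> ring

/-- The bilinear relations between the coordinates of `K(z₁)` and `K(z₂)`, where `X = z₁ ^ 2` and
`Y = z₂ ^ 2`, that are equivalent to the reflection equation. -/
structure Exchange (X Y : ℂ) (a b : Coords) : Prop where
  pr : a.p * b.r - a.r * b.p = 0
  pu : a.p * b.u - a.u * b.p = 0
  ru : a.r * b.u - a.u * b.r = 0
  wR : a.w * b.R - a.R * b.w = 0
  wP : a.w * b.P - a.P * b.w = 0
  RP : a.R * b.P - a.P * b.R = 0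
  sp : a.s * b.p - a.p * b.s = 0
  sr : a.s * b.r - a.r * b.s = 0
  sR : a.s * b.R - a.R * b.s = 0
  sP : a.s * b.P - a.P * b.s = 0
  su : a.s * b.u - a.u * b.s = 0
  sw : a.s * b.w - a.w * b.s = 0
  sS : a.s * b.S - a.S * b.s = 0
  Sp : a.S * b.p - a.p * b.S = 0
  Sr : a.S * b.r - a.r * b.S = 0
  SR : a.S * b.R - a.R * b.S = 0
  SP : a.S * b.P - a.P * b.S = 0
  Su : a.S * b.u - a.u * b.S = 0
  Sw : a.S * b.w - a.w * b.S = 0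
  pP : Y * a.p * b.P + (X - Y) * a.s * b.S - X * a.P * b.p = 0
  pR : X * a.R * b.p - Y * a.p * b.R - (X - Y) * a.u * b.s = 0
  rP : X * a.P * b.r - Y * a.r * b.P - (X - Y) * a.w * b.S = 0
  rR : (X - Y) * a.w * b.u + Y * a.r * b.R + (X - Y) * a.s * b.S - X * a.R * b.r -
      (X - Y) * a.P * b.p = 0
  uw : Y * a.u * b.w + (X - Y) * a.s * b.S - Y * a.w * b.u - (X - Y) * a.P * b.p = 0
  wp : X * a.w * b.p - Y * a.p * b.w - (X - Y) * a.s * b.r = 0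
  uP : Y * a.u * b.P + (X - Y) * a.S * b.R - X * a.P * b.u = 0
  wr : a.w * b.r + a.R * b.p - a.r * b.w - a.p * b.R = 0
  uR : a.u * b.R + a.r * b.P - a.R * b.u - a.P * b.r = 0
  fp : Y * (X ^ 2 - 1) * a.f * b.p + X * Y * (X - Y) * a.s * b.s +
      X * Y ^ 2 * (X - Y) * a.r * b.s + X ^ 2 * Y * (X - Y) * a.w * b.p -
      X * (Y ^ 2 - 1) * a.p * b.f - X * Y * (X - Y) * a.u * b.p = 0
  fs : Y ^ 2 * (X ^ 2 - 1) * a.f * b.s + X * Y * (X - Y) * a.S * b.p +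
      X ^ 2 * Y ^ 2 * (X - Y) * a.w * b.s - X ^ 2 * (Y ^ 2 - 1) * a.s * b.f = 0
  fr : Y * (X ^ 2 - 1) * a.f * b.r + X * Y ^ 2 * (X - Y) * a.R * b.p +
      X * Y * (X - Y) * a.w * b.s + X * Y * (X - Y) * (X + Y) * a.w * b.r -
      X * (Y ^ 2 - 1) * a.r * b.f - X * Y ^ 2 * (X - Y) * a.u * b.s -
      X * Y * (X - Y) * a.u * b.r = 0
  fu : Y * (X ^ 2 - 1) * a.f * b.u + X * Y * (X - Y) * a.R * b.s + X ^ 3 * Y * a.w * b.u -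
      X * (Y ^ 2 - 1) * a.u * b.f - X * Y * (X - Y) * a.u * b.u - X * Y ^ 3 * a.u * b.w = 0
  fw : Y ^ 2 * (X ^ 2 - 1) * a.f * b.w + X * Y * (X - Y) * a.S * b.r + X ^ 2 * Y ^ 2 * a.w * b.u +
      X ^ 2 * Y ^ 2 * (X - Y) * a.w * b.w - X ^ 2 * (Y ^ 2 - 1) * a.w * b.f -
      X ^ 2 * Y ^ 2 * a.u * b.w = 0
  fS : Y * (X ^ 2 - 1) * a.f * b.S + X * Y * (X - Y) * a.P * b.s +
      X * Y * (X - Y) * (X + Y) * a.w * b.S - X * (Y ^ 2 - 1) * a.S * b.f -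
      X * Y * (X - Y) * a.u * b.S = 0
  fR : Y ^ 2 * (X ^ 2 - 1) * a.f * b.R + X ^ 2 * Y ^ 2 * a.R * b.u + X * Y * (X - Y) * a.u * b.S +
      X ^ 2 * Y ^ 2 * (X - Y) * a.w * b.R - X ^ 2 * (Y ^ 2 - 1) * a.R * b.f -
      X ^ 2 * Y ^ 2 * a.u * b.R = 0
  fP : Y ^ 2 * (X ^ 2 - 1) * a.f * b.P + X * Y * (X - Y) * a.S * b.S +
      X * Y ^ 2 * (X - Y) * a.R * b.S + X ^ 2 * Y ^ 2 * (X - Y) * a.w * b.P -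
      X ^ 2 * (Y ^ 2 - 1) * a.P * b.f - X * Y ^ 2 * (X - Y) * a.u * b.P = 0

/-! ### The reflection equation in coordinates -/

/-- The polynomial matrix `(U - V) R(z, q)` for `z ^ 2 = U / V`, where `t = 1 / (q ^ 2 - 1)`. -/
def rPoly (U V t : ℂ) : Mat9 := Matrix.of fun i k =>
  if i.1 = i.2 ∧ i.2 = k.1 ∧ k.1 = k.2 then V - t * (U - V)
  else if i.1 = k.1 ∧ i.2 = k.2 then (if k.2 < k.1 then -(1 + t) * (U - V) else -t * (U - V))
  else if k.2 = i.1 ∧ k.1 = i.2 then (if k.1 < k.2 then U else V)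
  else if min k.1 k.2 < i.1 ∧ i.1 < max k.1 k.2 ∧
      (i.1 : ℕ) + (i.2 : ℕ) = (k.1 : ℕ) + (k.2 : ℕ) then
    (if k.1 < k.2 then U - V else V - U)
  else 0

/-- The reflection equation with the denominators cleared, for `X = z₁ ^ 2` and `Y = z₂ ^ 2`. -/
def PolyReflection (X Y t : ℂ) (A B : Mat3) : Prop :=
  rPoly X Y t * (A ⊗ₖ (1 : Mat3)) * (rPoly (X * Y) 1 t).submatrix Prod.swap Prod.swap *
      ((1 : Mat3) ⊗ₖ B) =
    ((1 : Mat3) ⊗ₖ B) * rPoly (X * Y) 1 t * (A ⊗ₖ (1 : Mat3)) *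
      (rPoly X Y t).submatrix Prod.swap Prod.swap

theorem reflection_lhs_apply (R S : Mat9) (A B : Mat3) (i j k l : Fin 3) :
    (R * (A ⊗ₖ (1 : Mat3)) * S * ((1 : Mat3) ⊗ₖ B)) (i, j) (k, l) =
      ∑ m, (∑ b, ∑ n, (∑ a, R (i, j) (a, n) * A a b) * S (b, n) (k, m)) * B m l := by
  simp [Matrix.mul_apply, Fintype.sum_prod_type, Matrix.one_apply]

theorem reflection_rhs_apply (R S : Mat9) (A B : Mat3) (i j k l : Fin 3) :
    (((1 : Mat3) ⊗ₖ B) * R * (A ⊗ₖ (1 : Mat3)) * S) (i, j) (k, l) =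
      ∑ m, B j m * ∑ b, ∑ n, (∑ a, R (i, m) (a, n) * A a b) * S (b, n) (k, l) := by
  simp only [Matrix.mul_assoc]
  simp [Matrix.mul_apply, Fintype.sum_prod_type, Matrix.one_apply, Fin.sum_univ_three]
  ring

set_option maxHeartbeats 8000000 in
-- Entry by entry, the difference of the two sides lies in the span of the exchange relations with
-- coefficients polynomial in X, Y, t. Nothing is divided, so no genericity is needed and t is
-- arbitrary.
theorem Exchange.polyReflection {X Y : ℂ} {a b : Coords} (h : Exchange X Y a b) (t : ℂ) :
    PolyReflection X Y t (a.toMatrix X) (b.toMatrix Y) := by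
  rw [PolyReflection]
  ext ⟨i, j⟩ ⟨k, l⟩
  rw [reflection_lhs_apply, reflection_rhs_apply]
  fin_cases i <;> fin_cases j <;> fin_cases k <;> fin_cases l
  all_goals
    conv_lhs => simp [rPoly, Coords.toMatrix, Fin.sum_univ_three]
    conv_rhs => simp [rPoly, Coords.toMatrix, Fin.sum_univ_three]
  all_goals try ring1
  · linear_combination Y * (-Y + t * (X - Y)) * h.sS + (Y - t * (X - Y)) * h.Sr + (-Y + t * (X -
      Y)) * h.pP
  · linear_combination -X * Y ^ 2 * h.sP + Y * (1 - t * (X * Y - 1)) * h.Su +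
      t * X * Y * (Y ^ 2 - 1) * h.Sw -
      t * h.fS
  · linear_combination X * Y ^ 2 * (1 - t * (X * Y - 1)) * h.wP + X * Y * (1 - t * Y * (X -
      Y)) * h.SR +
      Y * (-1 + t * (X * Y - 1)) * h.uP - t * h.fP
  · linear_combination t * X * Y * (X - Y) * h.sP + t * X * (Y ^ 2 - 1) * h.Su -
      t * X * Y * (Y ^ 2 - 1) * h.Sw +
      t * h.fS
  · linear_combination -t * X * Y * (X * Y - 1) * h.SP
  · linear_combination t * X ^ 2 * Y * (Y ^ 2 - 1) * h.wP + t * X * (X - Y) * (Y ^ 2 - 1) * h.SR -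
      t * X * (Y ^ 2 - 1) * h.uP + t * h.fP
  · linear_combination t * X * Y * (X * Y - 1) * h.SP
  · linear_combination Y * (-1 + t * (X * Y - 1)) * h.ru + X * Y * (-1 + t * (X * Y - 1)) * h.su -
      t * X ^ 2 * Y * (Y ^ 2 - 1) * h.sw + (Y - t * (X - Y)) * h.Sp +
      Y * (1 - t * (X * Y - 1)) * h.pR + t * X * Y * (Y ^ 2 - 1) * h.wr + t * h.fs + t * h.fr
  · linear_combination -X * Y ^ 2 * h.sR - t * X * Y * (X * Y - 1) * h.sS + Y * (-1 +
      t * (X * Y - 1)) * h.Sr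
  · linear_combination X * Y ^ 2 * h.wR + X * Y ^ 2 * (1 - t * (X * Y - 1)) * h.sP +
      Y * (-Y - t * (X - Y) * (X * Y - 1)) * h.Sw + Y * (-1 + t * (X * Y - 1)) * h.rP
  · linear_combination t * X * Y * (X - Y) * h.sR + t * X * h.uw + t * h.fu
  · linear_combination t * X * Y * (Y ^ 2 - 1) * h.Sw - t * h.fS
  · linear_combination -t * X * Y ^ 2 * (X * Y - 1) * h.wP - t * X * Y ^ 2 * (X - Y) * h.SR -
      t * h.fP
  · linear_combination t * X ^ 2 * Y * (Y ^ 2 - 1) * h.wR + t * X * (X * Y - 1) * h.Su -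
      t * X * Y * (Y ^ 2 - 1) * h.Sw + t * X * h.rP + t * X * Y * h.uR + t * h.fS + t * h.fR
  · linear_combination t * X * Y * (X * Y - 1) * h.SR
  · linear_combination -t * X * Y ^ 2 * (X * Y - 1) * h.RP - t * X * Y * (X * Y - 1) * h.SP
  · linear_combination Y * (-1 + t * (X * Y - 1)) * h.pu + Y * (Y + t * (X - Y) * (X * Y -
      1)) * h.sr +
      Y * (-1 + t * (X * Y - 1)) * h.wp + t * h.fp
  · linear_combination X * Y ^ 2 * h.sw + Y * (-1 + t * (X * Y - 1)) * h.Sp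
  · linear_combination X * Y ^ 2 * h.sR + Y * (Y + t * (X - Y) * (X * Y - 1)) * h.sS +
      Y * (1 - t * (X * Y - 1)) * h.pP
  · linear_combination t * X * Y * (X * Y - 1) * h.su - t * X * Y ^ 2 * (X * Y - 1) * h.sw +
      t * h.fs
  · linear_combination -t * X * Y * (X * Y - 1) * h.sS
  · linear_combination -t * X * Y ^ 2 * (X * Y - 1) * h.sP
  · linear_combination t * h.fu - t * h.fw
  · linear_combination -t * X * Y ^ 2 * (X - Y) * h.Sw - t * h.fS
  · linear_combination -t * X * Y ^ 2 * (X - Y) * h.SR - t * h.fP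
  · linear_combination -(1 + t) * X * (Y ^ 2 - 1) * h.ru - (1 + t) * X ^ 2 * (Y ^ 2 - 1) * h.su +
      (1 + t) * X ^ 2 * Y * (Y ^ 2 - 1) * h.sw + (X * Y - 1) * (-Y + t * (X - Y)) * h.Sp +
      (1 + t) * X * (Y ^ 2 - 1) * h.pR - (1 + t) * X * Y * (Y ^ 2 - 1) * h.wr - (1 + t) * h.fs -
      (1 + t) * h.fr
  · linear_combination Y * (X ^ 2 * Y - Y + t * (X - Y)) * h.sS + (1 + t) * (X - Y) * h.pP - (1 +
      t) * X * h.uw -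
      (1 + t) * h.fu
  · linear_combination -(1 + t) * X * Y ^ 2 * (X * Y - 1) * h.wR - t * X * Y * (X - Y) * h.sP +
      Y * (-X ^ 2 + 1 - t * (X * Y - 1)) * h.Su + Y ^ 2 * (X ^ 2 - 1 + t * (X * Y - 1)) * h.Sw -
      (1 + t) * Y * h.rP - (1 + t) * X * Y * h.uR - t * h.fS - (1 + t) * h.fR
  · linear_combination X * Y * (-1 + t * (X * Y - 1)) * h.sS + X * (1 - t * (X * Y - 1)) * h.Sr -
      X * h.pP
  · linear_combination X * Y * (-Y + t * (X - Y)) * h.sP + X * Y * (Y - t * (X - Y)) * h.Su -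
      (1 + t) * X * Y * (Y ^ 2 - 1) * h.Sw + (1 + t) * h.fS
  · linear_combination X ^ 2 * Y ^ 3 * h.wP + X * Y * (X * Y - Y ^ 2 + 1 - t * (X * Y - 1)) * h.SR -
      X * Y ^ 2 * h.uP + h.fP
  · linear_combination X * Y * (-X + Y + t * X * (X * Y - 1)) * h.sP - X * (Y ^ 2 - 1) * h.Su +
      X * Y * (Y ^ 2 - 1) * h.Sw - t * X * (X * Y - 1) * h.rP - h.fS
  · linear_combination t * X ^ 2 * Y * (Y ^ 2 - 1) * h.wP - t * X * Y * (X - Y) ^ 2 * h.SR +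
      t * X * Y * (X - Y) * h.uP + t * h.fP
  · linear_combination t * X ^ 2 * Y * (X * Y - 1) * h.RP + (1 + t) * X * Y * (X * Y - 1) * h.SP
  · linear_combination (X - Y) * (1 - t * (X * Y - 1)) * h.pu - X * Y ^ 2 * (X - Y) * h.sr -
      X * (Y ^ 2 - 1) * h.wp - h.fp
  · linear_combination -t * X ^ 2 * Y * (Y ^ 2 - 1) * h.sw - t * X * Y * (X - Y) * h.Sp -
      (1 + t) * Y * (X * Y - 1) * h.pR + (1 + t) * X * Y * (Y ^ 2 - 1) * h.wr + t * h.fs +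
      (1 + t) * h.fr
  · linear_combination -(1 + t) * X * Y ^ 2 * (X * Y - 1) * h.sR + Y ^ 2 * (-X ^ 2 + 1 -
      t * (X * Y - 1)) * h.sS +
      (1 + t) * Y * (X * Y - 1) * h.Sr + (X - Y) * (-1 + t * (X * Y - 1)) * h.pP -
      (1 + t) * Y * (X * Y - 1) * h.rR + (X * Y ^ 2 + X - Y - t * (X - Y) * (X * Y - 1)) * h.uw +
      h.fw
  · linear_combination X * Y * (-Y + t * (X - Y)) * h.ru + X * (-X * Y ^ 2 + t * (X - Y)) * h.su +
      (1 + t) * X ^ 2 * Y * (Y ^ 2 - 1) * h.sw + X * h.Sp + X * (Y ^ 2 + t * (Y ^ 2 - 1)) * h.pR -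
      (1 + t) * X * Y * (Y ^ 2 - 1) * h.wr - (1 + t) * h.fs - (1 + t) * h.fr
  · linear_combination X * Y * (-Y + t * (X - Y)) * h.sR + X * Y * (X * Y - 1) * h.sS +
      X * Y * (-Y + t * (X - Y)) * h.Sr
  · linear_combination X * Y ^ 2 * (1 - t * (X * Y - 1)) * h.wR + X * Y * (X * Y ^ 2 - t * (X -
      Y)) * h.sP +
      X * Y * (X * Y - Y ^ 2 - 1 + t * (X * Y - 1)) * h.Sw - (1 + t) * X * Y ^ 2 * h.rP -
      t * X ^ 2 * Y ^ 2 * h.uR - t * h.fS - t * h.fR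
  · linear_combination X * Y * (-X + Y + t * X * (X * Y - 1)) * h.sR + t * X * Y * (X * Y -
      1) * h.sS -
      t * X * (X * Y - 1) * h.Sr + t * X * (X * Y - 1) * h.rR - X * h.uw - h.fu
  · linear_combination t * X ^ 2 * Y * (Y ^ 2 - 1) * h.wR - (1 + t) * X * Y * (Y ^ 2 - 1) * h.Sw +
      t * X ^ 2 * Y * h.rP + t * X ^ 2 * Y ^ 2 * h.uR + (1 + t) * h.fS + t * h.fR
  · linear_combination X * Y * (X * Y - 1) * (Y - t * (X - Y)) * h.wP + X * Y ^ 2 * (X -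
      Y) * h.SR + h.fP
  · linear_combination -(1 + t) * Y * (X * Y - 1) * h.pr + t * X * Y * (X * Y - 1) * h.sp
  · linear_combination (1 + t) * Y * (X - Y) * (X * Y - 1) * h.sr + (1 + t) * Y * (X * Y -
      1) * h.wp +
      (1 + t) * h.fp
  · linear_combination (1 + t) * Y * (X * Y - 1) * h.Sp + (1 + t) * Y * (X * Y - 1) * h.pR + h.fs
  · linear_combination -X * Y ^ 2 * h.pu + X * Y * (-X * Y + Y ^ 2 + 1 - t * (X * Y - 1)) * h.sr -
      X * Y ^ 2 * h.wp - h.fp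
  · linear_combination X * Y ^ 2 * (1 - t * (X * Y - 1)) * h.sw - X * Y ^ 2 * h.Sp + t * h.fs
  · linear_combination X * Y ^ 2 * (1 - t * (X * Y - 1)) * h.sR +
      X * Y * (-X * Y + Y ^ 2 + 1 - t * (X * Y - 1)) * h.sS + X * Y ^ 2 * h.pP
  · linear_combination t * X * Y * (X - Y) * h.ru + X * Y * (-X * Y + 1 + t * X * (X - Y)) * h.su +
      X * Y ^ 2 * (X * Y - 1 - t * X * (X - Y)) * h.sw - t * X * Y * (X - Y) * h.pR +
      t * X * Y ^ 2 * (X - Y) * h.wr - (1 + t) * h.fs - t * h.fr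
  · linear_combination X * Y * (X * Y - 1) * h.sS + t * X * Y * (X - Y) * h.Sr -
      t * X ^ 2 * Y * h.uw - t * h.fw
  · linear_combination X * Y ^ 2 * (X * Y - 1 - t * X * (X - Y)) * h.sP - t * X * Y ^ 2 * h.rP -
      t * X ^ 2 * Y ^ 2 * h.uR - t * h.fS - t * h.fR
  · linear_combination -(1 + t) * X * (Y ^ 2 - 1) * h.pu - (1 + t) * X * Y ^ 2 * (X - Y) * h.sr -
      (1 + t) * X * (Y ^ 2 - 1) * h.wp - (1 + t) * h.fp
  · linear_combination -(1 + t) * X * Y * (X * Y - 1) * h.su + (1 + t) * X ^ 2 * Y * (Y ^ 2 -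
      1) * h.sw +
      (1 + t) * X * Y * (X - Y) * h.Sp - (1 + t) * h.fs
  · linear_combination -(1 + t) * X * Y * (X - Y) * h.sR - (1 + t) * X * Y * (X - Y) * h.Sr -
      (1 + t) * h.fu +
      (1 + t) * h.fw
  · linear_combination -(1 + t) * X * (X * Y - 1) * h.Sp
  · linear_combination (1 + t) * X * Y * (X * Y - 1) * h.sS
  · linear_combination (1 + t) * X * Y * (X - Y) * h.sP - (1 + t) * X * Y * (X - Y) * h.Su +
      (1 + t) * X * Y ^ 2 * (X - Y) * h.Sw + (1 + t) * h.fS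
  · linear_combination -X ^ 2 * Y ^ 2 * h.sS + X ^ 2 * Y * h.Sr + X * (-1 + t * (X * Y - 1)) * h.pP
  · linear_combination X ^ 2 * Y * (-1 + t * (X * Y - 1)) * h.sP + X ^ 2 * Y * h.Su
  · linear_combination X ^ 2 * Y ^ 2 * (Y - t * (X - Y)) * h.wP +
      X * Y * (2 * X * Y - Y ^ 2 - t * (X - Y) ^ 2) * h.SR + X * Y * (-Y + t * (X - Y)) * h.uP +
      (1 + t) * h.fP
  · linear_combination (1 + t) * X * (X * Y - 1) * h.pr - (1 + t) * X * Y * (X * Y - 1) * h.sp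
  · linear_combination (1 + t) * X * Y * (X * Y - 1) * h.sr
  · linear_combination (1 + t) * X * Y * (X - Y) * h.sw - (1 + t) * X * Y * (X - Y) * h.Sp -
      (1 + t) * X * Y ^ 2 * (X - Y) * h.wr + (1 + t) * h.fs + (1 + t) * h.fr
  · linear_combination (1 + t) * X * Y * (X - Y) * h.pu - (1 + t) * X * Y ^ 2 * (X - Y) * h.sr -
      (1 + t) * X * (Y ^ 2 - 1) * h.wp - (1 + t) * h.fp
  · linear_combination (1 + t) * X ^ 2 * Y * (Y ^ 2 - 1) * h.sw + (1 + t) * X * Y * (X - Y) * h.Sp -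
      (1 + t) * h.fs
  · linear_combination -(1 + t) * X * Y ^ 2 * (X - Y) * h.sS - (1 + t) * X * Y * (X - Y) * h.pP +
      (1 + t) * X ^ 2 * Y * h.uw + (1 + t) * h.fw
  · linear_combination -X ^ 2 * Y * h.ru + X * (-X * Y ^ 2 - X + Y + t * (X - Y) * (X * Y -
      1)) * h.su +
      X * (1 - t * (X * Y - 1)) * h.Sp + X * (1 - t * (X * Y - 1)) * h.pR
  · linear_combination X ^ 2 * Y * (-1 + t * (X * Y - 1)) * h.sR + (1 + t) * X * Y * (X * Y -
      1) * h.sS -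
      X ^ 2 * Y * h.Sr
  · linear_combination X ^ 2 * Y ^ 2 * (Y - t * (X - Y)) * h.wR +
      X * Y * (X * Y ^ 2 + X - Y - t * (X - Y) * (X * Y - 1)) * h.sP +
      X * Y ^ 2 * (-Y + t * (X - Y)) * h.Sw + t * X ^ 2 * Y * h.rP +
      (1 + t) * X ^ 2 * Y ^ 2 * h.uR + (1 + t) * h.fS + (1 + t) * h.fR
  · linear_combination (1 + t) * X * Y * (X * Y - 1) * h.sp
  · linear_combination (1 + t) * h.fp
  · linear_combination -(1 + t) * X * Y * (X * Y - 1) * h.sp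
  · linear_combination (1 + t) * h.fs
  · linear_combination X * Y * (-Y + t * (X - Y)) * h.pu + X * Y ^ 2 * (Y - t * (X - Y)) * h.sr +
      X * Y * (-Y + t * (X - Y)) * h.wp - (1 + t) * h.fp
  · linear_combination X ^ 2 * Y ^ 2 * (Y - t * (X - Y)) * h.sw + X * Y * (-Y + t * (X -
      Y)) * h.Sp -
      (1 + t) * h.fs
  · linear_combination X ^ 2 * Y ^ 2 * (Y - t * (X - Y)) * h.sR + X * Y ^ 2 * (Y - t * (X -
      Y)) * h.sS +
      X * Y * (Y - t * (X - Y)) * h.pP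

set_option maxHeartbeats 8000000 in
-- The linear system expressing the entries through the 36 relations can be solved triangularly: 37
-- entries suffice, and the pivots are products of t, 1 + t, X, Y, XY - 1 and Y² - 1.
theorem exchange_of_polyReflection {X Y t : ℂ} {a b : Coords} (hX : X ≠ 0) (hY : Y ≠ 0)
    (hY1 : Y ^ 2 - 1 ≠ 0) (hm : X * Y - 1 ≠ 0) (ht : t ≠ 0) (ht1 : 1 + t ≠ 0)
    (h : PolyReflection X Y t (a.toMatrix X) (b.toMatrix Y)) : Exchange X Y a b := by
  rw [PolyReflection] at h
  have e2201 := congrFun (congrFun h (2, 2)) (0, 1)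
  have e1200 := congrFun (congrFun h (1, 2)) (0, 0)
  have e2101 := congrFun (congrFun h (2, 1)) (0, 1)
  have e2202 := congrFun (congrFun h (2, 2)) (0, 2)
  have e1201 := congrFun (congrFun h (1, 2)) (0, 1)
  have e1210 := congrFun (congrFun h (1, 2)) (1, 0)
  have e2010 := congrFun (congrFun h (2, 0)) (1, 0)
  have e0201 := congrFun (congrFun h (0, 2)) (0, 1)
  have e1211 := congrFun (congrFun h (1, 2)) (1, 1)
  have e0210 := congrFun (congrFun h (0, 2)) (1, 0)
  have e1202 := congrFun (congrFun h (1, 2)) (0, 2)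
  have e2120 := congrFun (congrFun h (2, 1)) (2, 0)
  have e0100 := congrFun (congrFun h (0, 1)) (0, 0)
  have e1220 := congrFun (congrFun h (1, 2)) (2, 0)
  have e0211 := congrFun (congrFun h (0, 2)) (1, 1)
  have e0101 := congrFun (congrFun h (0, 1)) (0, 1)
  have e0202 := congrFun (congrFun h (0, 2)) (0, 2)
  have e1010 := congrFun (congrFun h (1, 0)) (1, 0)
  have e2020 := congrFun (congrFun h (2, 0)) (2, 0)
  have e0110 := congrFun (congrFun h (0, 1)) (1, 0)
  have e0220 := congrFun (congrFun h (0, 2)) (2, 0)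
  have e1221 := congrFun (congrFun h (1, 2)) (2, 1)
  have e1102 := congrFun (congrFun h (1, 1)) (0, 2)
  have e0212 := congrFun (congrFun h (0, 2)) (1, 2)
  have e2021 := congrFun (congrFun h (2, 0)) (2, 1)
  have e0001 := congrFun (congrFun h (0, 0)) (0, 1)
  have e0221 := congrFun (congrFun h (0, 2)) (2, 1)
  have e1020 := congrFun (congrFun h (1, 0)) (2, 0)
  have e0102 := congrFun (congrFun h (0, 1)) (0, 2)
  have e0120 := congrFun (congrFun h (0, 1)) (2, 0)
  have e1112 := congrFun (congrFun h (1, 1)) (1, 2)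
  have e0121 := congrFun (congrFun h (0, 1)) (2, 1)
  have e0222 := congrFun (congrFun h (0, 2)) (2, 2)
  have e0112 := congrFun (congrFun h (0, 1)) (1, 2)
  have e0020 := congrFun (congrFun h (0, 0)) (2, 0)
  have e0012 := congrFun (congrFun h (0, 0)) (1, 2)
  have e0122 := congrFun (congrFun h (0, 1)) (2, 2)
  rw [reflection_lhs_apply, reflection_rhs_apply] at e2201 e1200 e2101 e2202 e1201 e1210 e2010 e0201
  rw [reflection_lhs_apply, reflection_rhs_apply] at e1211 e0210 e1202 e2120 e0100 e1220 e0211 e0101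
  rw [reflection_lhs_apply, reflection_rhs_apply] at e0202 e1010 e2020 e0110 e0220 e1221 e1102 e0212
  rw [reflection_lhs_apply, reflection_rhs_apply] at e2021 e0001 e0221 e1020 e0102 e0120 e1112 e0121
  rw [reflection_lhs_apply, reflection_rhs_apply] at e0222 e0112 e0020 e0012 e0122
  conv at e2201 => congr <;> simp [rPoly, Coords.toMatrix, Fin.sum_univ_three]
  conv at e1200 => congr <;> simp [rPoly, Coords.toMatrix, Fin.sum_univ_three]
  conv at e2101 => congr <;> simp [rPoly, Coords.toMatrix, Fin.sum_univ_three]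
  conv at e2202 => congr <;> simp [rPoly, Coords.toMatrix, Fin.sum_univ_three]
  conv at e1201 => congr <;> simp [rPoly, Coords.toMatrix, Fin.sum_univ_three]
  conv at e1210 => congr <;> simp [rPoly, Coords.toMatrix, Fin.sum_univ_three]
  conv at e2010 => congr <;> simp [rPoly, Coords.toMatrix, Fin.sum_univ_three]
  conv at e0201 => congr <;> simp [rPoly, Coords.toMatrix, Fin.sum_univ_three]
  conv at e1211 => congr <;> simp [rPoly, Coords.toMatrix, Fin.sum_univ_three]
  conv at e0210 => congr <;> simp [rPoly, Coords.toMatrix, Fin.sum_univ_three]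
  conv at e1202 => congr <;> simp [rPoly, Coords.toMatrix, Fin.sum_univ_three]
  conv at e2120 => congr <;> simp [rPoly, Coords.toMatrix, Fin.sum_univ_three]
  conv at e0100 => congr <;> simp [rPoly, Coords.toMatrix, Fin.sum_univ_three]
  conv at e1220 => congr <;> simp [rPoly, Coords.toMatrix, Fin.sum_univ_three]
  conv at e0211 => congr <;> simp [rPoly, Coords.toMatrix, Fin.sum_univ_three]
  conv at e0101 => congr <;> simp [rPoly, Coords.toMatrix, Fin.sum_univ_three]
  conv at e0202 => congr <;> simp [rPoly, Coords.toMatrix, Fin.sum_univ_three]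
  conv at e1010 => congr <;> simp [rPoly, Coords.toMatrix, Fin.sum_univ_three]
  conv at e2020 => congr <;> simp [rPoly, Coords.toMatrix, Fin.sum_univ_three]
  conv at e0110 => congr <;> simp [rPoly, Coords.toMatrix, Fin.sum_univ_three]
  conv at e0220 => congr <;> simp [rPoly, Coords.toMatrix, Fin.sum_univ_three]
  conv at e1221 => congr <;> simp [rPoly, Coords.toMatrix, Fin.sum_univ_three]
  conv at e1102 => congr <;> simp [rPoly, Coords.toMatrix, Fin.sum_univ_three]
  conv at e0212 => congr <;> simp [rPoly, Coords.toMatrix, Fin.sum_univ_three]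
  conv at e2021 => congr <;> simp [rPoly, Coords.toMatrix, Fin.sum_univ_three]
  conv at e0001 => congr <;> simp [rPoly, Coords.toMatrix, Fin.sum_univ_three]
  conv at e0221 => congr <;> simp [rPoly, Coords.toMatrix, Fin.sum_univ_three]
  conv at e1020 => congr <;> simp [rPoly, Coords.toMatrix, Fin.sum_univ_three]
  conv at e0102 => congr <;> simp [rPoly, Coords.toMatrix, Fin.sum_univ_three]
  conv at e0120 => congr <;> simp [rPoly, Coords.toMatrix, Fin.sum_univ_three]
  conv at e1112 => congr <;> simp [rPoly, Coords.toMatrix, Fin.sum_univ_three]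
  conv at e0121 => congr <;> simp [rPoly, Coords.toMatrix, Fin.sum_univ_three]
  conv at e0222 => congr <;> simp [rPoly, Coords.toMatrix, Fin.sum_univ_three]
  conv at e0112 => congr <;> simp [rPoly, Coords.toMatrix, Fin.sum_univ_three]
  conv at e0020 => congr <;> simp [rPoly, Coords.toMatrix, Fin.sum_univ_three]
  conv at e0012 => congr <;> simp [rPoly, Coords.toMatrix, Fin.sum_univ_three]
  conv at e0122 => congr <;> simp [rPoly, Coords.toMatrix, Fin.sum_univ_three]
  -- The order matters from here on: each relation is isolated, up to a nonzero pivot, modulo those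
  -- already obtained.
  have sp : a.s * b.p - a.p * b.s = 0 := by
    refine (mul_eq_zero.1 (?_ : (1 + t) * X * Y * (X * Y - 1) * (_ : ℂ) = 0)).resolve_left
      (mul_ne_zero (mul_ne_zero (mul_ne_zero ht1 hX) hY) hm)
    linear_combination e2201
  have pr : a.p * b.r - a.r * b.p = 0 := by
    refine (mul_eq_zero.1 (?_ : (1 + t) * Y * (X * Y - 1) * (_ : ℂ) = 0)).resolve_left
      (mul_ne_zero (mul_ne_zero ht1 hY) hm)
    linear_combination -e1200 + t * X * Y * (X * Y - 1) * sp
  have sr : a.s * b.r - a.r * b.s = 0 := by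
    refine (mul_eq_zero.1 (?_ : (1 + t) * X * Y * (X * Y - 1) * (_ : ℂ) = 0)).resolve_left
      (mul_ne_zero (mul_ne_zero (mul_ne_zero ht1 hX) hY) hm)
    linear_combination e2101
  have fp : Y * (X ^ 2 - 1) * a.f * b.p + X * Y * (X - Y) * a.s * b.s +
      X * Y ^ 2 * (X - Y) * a.r * b.s + X ^ 2 * Y * (X - Y) * a.w * b.p -
      X * (Y ^ 2 - 1) * a.p * b.f - X * Y * (X - Y) * a.u * b.p = 0 := by
    refine (mul_eq_zero.1 (?_ : (1 + t) * (_ : ℂ) = 0)).resolve_left ht1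
    linear_combination e2202
  have wp : X * a.w * b.p - Y * a.p * b.w - (X - Y) * a.s * b.r = 0 := by
    refine (mul_eq_zero.1 (?_ : (1 + t) * Y * (X * Y - 1) * (_ : ℂ) = 0)).resolve_left
      (mul_ne_zero (mul_ne_zero ht1 hY) hm)
    linear_combination e1201 - (1 + t) * Y * (X - Y) * (X * Y - 1) * sr - (1 + t) * fp
  have pu : a.p * b.u - a.u * b.p = 0 := by
    refine (mul_eq_zero.1 (?_ : X * Y * Y * (_ : ℂ) = 0)).resolve_left
      (mul_ne_zero (mul_ne_zero hX hY) hY)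
    linear_combination -e1210 + X * Y * (-X * Y + Y ^ 2 + 1 - t * (X * Y - 1)) * sr -
      X * Y ^ 2 * wp - fp
  have Sp : a.S * b.p - a.p * b.S = 0 := by
    refine (mul_eq_zero.1 (?_ : (1 + t) * X * (X * Y - 1) * (_ : ℂ) = 0)).resolve_left
      (mul_ne_zero (mul_ne_zero ht1 hX) hm)
    linear_combination -e2010
  have sw : a.s * b.w - a.w * b.s = 0 := by
    refine (mul_eq_zero.1 (?_ : X * Y * Y * (_ : ℂ) = 0)).resolve_left
      (mul_ne_zero (mul_ne_zero hX hY) hY)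
    linear_combination e0201 - Y * (-1 + t * (X * Y - 1)) * Sp
  have fs : Y ^ 2 * (X ^ 2 - 1) * a.f * b.s + X * Y * (X - Y) * a.S * b.p +
      X ^ 2 * Y ^ 2 * (X - Y) * a.w * b.s - X ^ 2 * (Y ^ 2 - 1) * a.s * b.f = 0 := by
    refine (mul_eq_zero.1 (?_ : t * (_ : ℂ) = 0)).resolve_left ht
    linear_combination e1211 - X * Y ^ 2 * (1 - t * (X * Y - 1)) * sw + X * Y ^ 2 * Sp
  have su : a.s * b.u - a.u * b.s = 0 := by
    refine (mul_eq_zero.1 (?_ : t * X * Y * (X * Y - 1) * (_ : ℂ) = 0)).resolve_left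
      (mul_ne_zero (mul_ne_zero (mul_ne_zero ht hX) hY) hm)
    linear_combination e0210 + t * X * Y ^ 2 * (X * Y - 1) * sw - t * fs
  have pR : X * a.R * b.p - Y * a.p * b.R - (X - Y) * a.u * b.s = 0 := by
    refine (mul_eq_zero.1 (?_ : (1 + t) * Y * (X * Y - 1) * (_ : ℂ) = 0)).resolve_left
      (mul_ne_zero (mul_ne_zero ht1 hY) hm)
    linear_combination e1202 - (1 + t) * Y * (X * Y - 1) * Sp - fs
  have ru : a.r * b.u - a.u * b.r = 0 := by
    refine (mul_eq_zero.1 (?_ : X * X * Y * (_ : ℂ) = 0)).resolve_left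
      (mul_ne_zero (mul_ne_zero hX hX) hY)
    linear_combination -e2120 + X * (-X * Y ^ 2 - X + Y + t * (X - Y) * (X * Y - 1)) * su +
      X * (1 - t * (X * Y - 1)) * Sp + X * (1 - t * (X * Y - 1)) * pR
  have fr : Y * (X ^ 2 - 1) * a.f * b.r + X * Y ^ 2 * (X - Y) * a.R * b.p +
      X * Y * (X - Y) * a.w * b.s + X * Y * (X - Y) * (X + Y) * a.w * b.r -
      X * (Y ^ 2 - 1) * a.r * b.f - X * Y ^ 2 * (X - Y) * a.u * b.s -
      X * Y * (X - Y) * a.u * b.r = 0 := by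
    refine (mul_eq_zero.1 (?_ : t * (X * Y - 1) * (_ : ℂ) = 0)).resolve_left (mul_ne_zero ht hm)
    -- No single entry isolates `fr`. The multipliers of `e0100` and `e1220` are chosen so that the
    -- still unknown `wr` cancels, leaving the pivot t(XY - 1).
    linear_combination Y * (X - Y) * e0100 - (Y ^ 2 - 1) * e1220 - Y * (X - Y) * (-Y + t * (X -
      Y)) * ru -
      X * Y * (X * Y ^ 3 - 2 * X * Y + 1 + t * (X - Y) ^ 2) * su +
      X * Y ^ 2 * (X * Y - 1) * (Y ^ 2 - 1) * sw - Y * (X - Y) * (Y - t * (X - Y)) * Sp -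
      Y * (X - Y) * (Y - t * (X - Y)) * pR - (Y ^ 2 - 1 + t * (X * Y - 1)) * fs
  have wr : a.w * b.r + a.R * b.p - a.r * b.w - a.p * b.R = 0 := by
    refine (mul_eq_zero.1 (?_ : t * X * Y * (Y ^ 2 - 1) * (_ : ℂ) = 0)).resolve_left
      (mul_ne_zero (mul_ne_zero (mul_ne_zero ht hX) hY) hY1)
    linear_combination e0100 - Y * (-1 + t * (X * Y - 1)) * ru - X * Y * (-1 + t * (X * Y -
      1)) * su +
      t * X ^ 2 * Y * (Y ^ 2 - 1) * sw - (Y - t * (X - Y)) * Sp - Y * (1 - t * (X * Y - 1)) * pR -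
      t * fs - t * fr
  have sS : a.s * b.S - a.S * b.s = 0 := by
    refine (mul_eq_zero.1 (?_ : t * X * Y * (X * Y - 1) * (_ : ℂ) = 0)).resolve_left
      (mul_ne_zero (mul_ne_zero (mul_ne_zero ht hX) hY) hm)
    linear_combination -e0211
  have pP : Y * a.p * b.P + (X - Y) * a.s * b.S - X * a.P * b.p = 0 := by
    refine (mul_eq_zero.1 (?_ : t * X * Y * (X * Y - 1) * (_ : ℂ) = 0)).resolve_left
      (mul_ne_zero (mul_ne_zero (mul_ne_zero ht hX) hY) hm)
    -- This combination eliminates `sR` and `Sr`, which are not yet available.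
    linear_combination -X * e0101 - X * e0202 - Y * e1010
  have sR : a.s * b.R - a.R * b.s = 0 := by
    refine (mul_eq_zero.1 (?_ : X * Y * Y * (_ : ℂ) = 0)).resolve_left
      (mul_ne_zero (mul_ne_zero hX hY) hY)
    linear_combination e0202 - Y * (Y + t * (X - Y) * (X * Y - 1)) * sS - Y * (1 - t * (X * Y -
      1)) * pP
  have Sr : a.S * b.r - a.r * b.S = 0 := by
    refine (mul_eq_zero.1 (?_ : X * X * Y * (_ : ℂ) = 0)).resolve_left
      (mul_ne_zero (mul_ne_zero hX hX) hY)
    linear_combination e2020 + X ^ 2 * Y ^ 2 * sS - X * (-1 + t * (X * Y - 1)) * pP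
  have fu : Y * (X ^ 2 - 1) * a.f * b.u + X * Y * (X - Y) * a.R * b.s + X ^ 3 * Y * a.w * b.u -
      X * (Y ^ 2 - 1) * a.u * b.f - X * Y * (X - Y) * a.u * b.u - X * Y ^ 3 * a.u * b.w = 0 := by
    refine (mul_eq_zero.1 (?_ : t * (X * Y - 1) * (_ : ℂ) = 0)).resolve_left (mul_ne_zero ht hm)
    -- Here `uw` and `fw`, both still unknown, cancel.
    linear_combination X * Y * e0110 - e0220 + e1221 - t * X ^ 2 * Y ^ 2 * (X - Y) * sR -
      X * Y * (X * Y - 1) * sS - t * X * Y * (X - Y) * Sr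
  have uw : Y * a.u * b.w + (X - Y) * a.s * b.S - Y * a.w * b.u - (X - Y) * a.P * b.p = 0 := by
    refine (mul_eq_zero.1 (?_ : t * X * (_ : ℂ) = 0)).resolve_left (mul_ne_zero ht hX)
    linear_combination e0110 - t * X * Y * (X - Y) * sR - t * fu
  have fw : Y ^ 2 * (X ^ 2 - 1) * a.f * b.w + X * Y * (X - Y) * a.S * b.r +
      X ^ 2 * Y ^ 2 * a.w * b.u +
      X ^ 2 * Y ^ 2 * (X - Y) * a.w * b.w - X ^ 2 * (Y ^ 2 - 1) * a.w * b.f -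
      X ^ 2 * Y ^ 2 * a.u * b.w = 0 := by
    refine (mul_eq_zero.1 (?_ : t * (_ : ℂ) = 0)).resolve_left ht
    linear_combination -e0220 + t * fu
  have rR : (X - Y) * a.w * b.u + Y * a.r * b.R + (X - Y) * a.s * b.S - X * a.R * b.r -
      (X - Y) * a.P * b.p = 0 := by
    refine (mul_eq_zero.1 (?_ : (1 + t) * Y * (X * Y - 1) * (_ : ℂ) = 0)).resolve_left
      (mul_ne_zero (mul_ne_zero ht1 hY) hm)
    linear_combination -e1102 - (1 + t) * X * Y ^ 2 * (X * Y - 1) * sR +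
      Y ^ 2 * (-X ^ 2 + 1 - t * (X * Y - 1)) * sS + (1 + t) * Y * (X * Y - 1) * Sr +
      (X - Y) * (-1 + t * (X * Y - 1)) * pP +
      (X * Y ^ 2 + X - Y - t * (X - Y) * (X * Y - 1)) * uw + fw
  have sP : a.s * b.P - a.P * b.s = 0 := by
    refine (mul_eq_zero.1 (?_ : t * X * Y * Y * (X * Y - 1) * (_ : ℂ) = 0)).resolve_left
      (mul_ne_zero (mul_ne_zero (mul_ne_zero (mul_ne_zero ht hX) hY) hY) hm)
    linear_combination -e0212
  have Su : a.S * b.u - a.u * b.S = 0 := by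
    refine (mul_eq_zero.1 (?_ : X * X * Y * (_ : ℂ) = 0)).resolve_left
      (mul_ne_zero (mul_ne_zero hX hX) hY)
    linear_combination e2021 - X ^ 2 * Y * (-1 + t * (X * Y - 1)) * sP
  have Sw : a.S * b.w - a.w * b.S = 0 := by
    refine (mul_eq_zero.1 (?_ : t * X * Y * (X * Y - 1) * (_ : ℂ) = 0)).resolve_left
      (mul_ne_zero (mul_ne_zero (mul_ne_zero ht hX) hY) hm)
    linear_combination e0001 - e0221 + X * Y ^ 2 * sP - Y * (1 - t * (X * Y - 1)) * Su
  have fS : Y * (X ^ 2 - 1) * a.f * b.S + X * Y * (X - Y) * a.P * b.s +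
      X * Y * (X - Y) * (X + Y) * a.w * b.S - X * (Y ^ 2 - 1) * a.S * b.f -
      X * Y * (X - Y) * a.u * b.S = 0 := by
    refine (mul_eq_zero.1 (?_ : t * (_ : ℂ) = 0)).resolve_left ht
    linear_combination -e0001 - X * Y ^ 2 * sP + Y * (1 - t * (X * Y - 1)) * Su +
      t * X * Y * (Y ^ 2 - 1) * Sw
  have rP : X * a.P * b.r - Y * a.r * b.P - (X - Y) * a.w * b.S = 0 := by
    refine (mul_eq_zero.1 (?_ : t * X * (X * Y - 1) * (_ : ℂ) = 0)).resolve_left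
      (mul_ne_zero (mul_ne_zero ht hX) hm)
    linear_combination -e1020 + X * Y * (-X + Y + t * X * (X * Y - 1)) * sP - X * (Y ^ 2 - 1) * Su +
      X * Y * (Y ^ 2 - 1) * Sw - fS
  have wR : a.w * b.R - a.R * b.w = 0 := by
    refine (mul_eq_zero.1 (?_ : X * Y * Y * (_ : ℂ) = 0)).resolve_left
      (mul_ne_zero (mul_ne_zero hX hY) hY)
    linear_combination e0102 - X * Y ^ 2 * (1 - t * (X * Y - 1)) * sP - Y * (-Y - t * (X -
      Y) * (X * Y - 1)) * Sw -
      Y * (-1 + t * (X * Y - 1)) * rP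
  have fR : Y ^ 2 * (X ^ 2 - 1) * a.f * b.R + X ^ 2 * Y ^ 2 * a.R * b.u + X * Y * (X -
      Y) * a.u * b.S +
      X ^ 2 * Y ^ 2 * (X - Y) * a.w * b.R - X ^ 2 * (Y ^ 2 - 1) * a.R * b.f -
      X ^ 2 * Y ^ 2 * a.u * b.R = 0 := by
    refine (mul_eq_zero.1 (?_ : t * (X * Y - 1) * (_ : ℂ) = 0)).resolve_left (mul_ne_zero ht hm)
    linear_combination X * Y * e0120 + e1112 - X * Y ^ 2 * (1 + t * (X ^ 2 * Y ^ 2 - X ^ 2 -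
      X * Y + 1)) * wR -
      X * Y * (X * Y ^ 2 - t * (X - Y)) * sP - t * X ^ 2 * Y * (X * Y - 1) * Su -
      X * Y * (X * Y - Y ^ 2 - 1 - t * (X * Y ^ 3 - 2 * X * Y + 1)) * Sw -
      X * Y * (-Y + t * (X - Y)) * rP - t * (X * Y - 1) * fS
  have uR : a.u * b.R + a.r * b.P - a.R * b.u - a.P * b.r = 0 := by
    refine (mul_eq_zero.1 (?_ : t * X * Y * (_ : ℂ) = 0)).resolve_left
      (mul_ne_zero (mul_ne_zero ht hX) hY)
    linear_combination e0120 - t * X ^ 2 * Y * (Y ^ 2 - 1) * wR - t * X * (X * Y - 1) * Su +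
      t * X * Y * (Y ^ 2 - 1) * Sw - t * X * rP - t * fS - t * fR
  have SR : a.S * b.R - a.R * b.S = 0 := by
    refine (mul_eq_zero.1 (?_ : t * X * Y * (X * Y - 1) * (_ : ℂ) = 0)).resolve_left
      (mul_ne_zero (mul_ne_zero (mul_ne_zero ht hX) hY) hm)
    linear_combination e0121
  have fP : Y ^ 2 * (X ^ 2 - 1) * a.f * b.P + X * Y * (X - Y) * a.S * b.S +
      X * Y ^ 2 * (X - Y) * a.R * b.S + X ^ 2 * Y ^ 2 * (X - Y) * a.w * b.P -
      X ^ 2 * (Y ^ 2 - 1) * a.P * b.f - X * Y ^ 2 * (X - Y) * a.u * b.P = 0 := by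
    refine (mul_eq_zero.1 (?_ : t * (_ : ℂ) = 0)).resolve_left ht
    linear_combination -e0222 - t * X * Y ^ 2 * (X - Y) * SR
  have wP : a.w * b.P - a.P * b.w = 0 := by
    refine (mul_eq_zero.1 (?_ : t * X * Y * Y * (X * Y - 1) * (_ : ℂ) = 0)).resolve_left
      (mul_ne_zero (mul_ne_zero (mul_ne_zero (mul_ne_zero ht hX) hY) hY) hm)
    linear_combination -e0112 - t * X * Y ^ 2 * (X - Y) * SR - t * fP
  have uP : Y * a.u * b.P + (X - Y) * a.S * b.R - X * a.P * b.u = 0 := by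
    refine (mul_eq_zero.1 (?_ : t * X * (Y ^ 2 - 1) * (_ : ℂ) = 0)).resolve_left
      (mul_ne_zero (mul_ne_zero ht hX) hY1)
    linear_combination -e0020 + t * X ^ 2 * Y * (Y ^ 2 - 1) * wP + t * X * (X - Y) * (Y ^ 2 -
      1) * SR + t * fP
  have SP : a.S * b.P - a.P * b.S = 0 := by
    refine (mul_eq_zero.1 (?_ : t * X * Y * (X * Y - 1) * (_ : ℂ) = 0)).resolve_left
      (mul_ne_zero (mul_ne_zero (mul_ne_zero ht hX) hY) hm)
    linear_combination -e0012
  have RP : a.R * b.P - a.P * b.R = 0 := by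
    refine (mul_eq_zero.1 (?_ : t * X * Y * Y * (X * Y - 1) * (_ : ℂ) = 0)).resolve_left
      (mul_ne_zero (mul_ne_zero (mul_ne_zero (mul_ne_zero ht hX) hY) hY) hm)
    linear_combination -e0122 - t * X * Y * (X * Y - 1) * SP
  exact ⟨pr, pu, ru, wR, wP, RP, sp, sr, sR, sP, su, sw, sS, Sp, Sr, SR, SP, Su, Sw,
    pP, pR, rP, rR, uw, wp, uP, wr, uR, fp, fs, fr, fu, fw, fS, fR, fP⟩


/-! ### Clearing denominators -/

theorem sgn_of_lt {k l : Fin 3} (h : k < l) : sgn k l = -1 :=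
  Int.sign_eq_neg_one_of_neg (by have : (k : ℕ) < l := h; omega)

theorem sgn_of_gt {k l : Fin 3} (h : l < k) : sgn k l = 1 :=
  Int.sign_eq_one_of_pos (by have : (l : ℕ) < k := h; omega)

/-- Keeping U and V separate lets one polynomial matrix serve both arguments: z₁/z₂ with (U, V) =
(X, Y), and z₁z₂ with (U, V) = (XY, 1). -/
theorem rPoly_eq_smul_R12 {q z U V : ℂ} (hq : q ≠ 0) (hq1 : q ^ 2 ≠ 1) (hz : z ≠ 0) (hV : V ≠ 0)
    (hzU : z ^ 2 * V = U) (hUV : U - V ≠ 0) :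
    rPoly U V (1 / (q ^ 2 - 1)) = (U - V) • R12 z q := by
  have h1 : q ^ 2 - 1 ≠ 0 := sub_ne_zero.2 hq1
  have h2 : z ^ 2 - 1 ≠ 0 := by
    rintro h
    exact hUV (by linear_combination -hzU + V * h)
  have h3 : q - q⁻¹ = (q ^ 2 - 1) / q := by field_simp
  have h4 : z - z⁻¹ = (z ^ 2 - 1) / z := by field_simp
  subst hzU
  ext ⟨i, j⟩ ⟨k, l⟩
  simp only [rPoly, R12, rEntry, Matrix.of_apply, Matrix.smul_apply, smul_eq_mul]
  by_cases c1 : i = j ∧ j = k ∧ k = l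
  · rw [if_pos c1, if_pos c1, h3, h4]
    field_simp
    ring
  rw [if_neg c1, if_neg c1]
  by_cases c2 : i = k ∧ j = l
  · rw [if_pos c2, if_pos c2, h3]
    rcases lt_trichotomy k l with h | h | h
    · rw [if_neg h.not_gt, sgn_of_lt h, zpow_neg_one]
      field_simp
    · exact absurd ⟨by rw [c2.1, c2.2, h], by rw [c2.2, h], h⟩ c1
    · rw [if_pos h, sgn_of_gt h, zpow_one]
      field_simp
      ring
  rw [if_neg c2, if_neg c2]
  by_cases c3 : l = i ∧ k = j
  · rw [if_pos c3, if_pos c3, h4]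
    rcases lt_trichotomy k l with h | h | h
    · rw [if_pos h, sgn_of_gt h, zpow_one]
      field_simp
    · exact absurd ⟨by rw [← c3.1, ← c3.2, h], c3.2.symm, h⟩ c1
    · rw [if_neg h.not_gt, sgn_of_lt h, zpow_neg_one]
      field_simp
  rw [if_neg c3, if_neg c3]
  by_cases c4 : min k l < i ∧ i < max k l ∧ (i : ℕ) + (j : ℕ) = (k : ℕ) + (l : ℕ)
  · rw [if_pos c4, if_pos c4]
    rcases lt_trichotomy k l with h | h | h
    · rw [if_pos h, sgn_of_gt h]
      simp
    · rw [h, min_self, max_self] at c4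
      exact absurd c4.1 c4.2.1.not_gt
    · rw [if_neg h.not_gt, sgn_of_lt h]
      simp
  · rw [if_neg c4, if_neg c4, mul_zero]

theorem smul_polyReflection {X Y t : ℂ} {A B : Mat3} (h : PolyReflection X Y t A B) (c d : ℂ) :
    PolyReflection X Y t (c • A) (d • B) := by
  unfold PolyReflection at *
  simp only [Matrix.smul_kronecker, Matrix.kronecker_smul, Matrix.mul_smul, Matrix.smul_mul, h]
  exact smul_comm d c _

/-- Each side contains one R-matrix at z/w and one at zw, so both acquire the same nonzero scalar
when denominators are cleared. -/
theorem polyReflection_iff {q z w : ℂ} (hq : q ≠ 0) (hq1 : q ^ 2 ≠ 1) (hz : z ≠ 0) (hw : w ≠ 0)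
    (h1 : z ^ 2 - w ^ 2 ≠ 0) (h2 : z ^ 2 * w ^ 2 - 1 ≠ 0) (A B : Mat3) :
    R12 (z / w) q * (A ⊗ₖ (1 : Mat3)) * R21 (z * w) q * ((1 : Mat3) ⊗ₖ B) =
        ((1 : Mat3) ⊗ₖ B) * R12 (z * w) q * (A ⊗ₖ (1 : Mat3)) * R21 (z / w) q ↔
      PolyReflection (z ^ 2) (w ^ 2) (1 / (q ^ 2 - 1)) A B := by
  have e1 := rPoly_eq_smul_R12 (U := z ^ 2) (V := w ^ 2) hq hq1 (div_ne_zero hz hw)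
    (pow_ne_zero 2 hw) (by field_simp) h1
  have e2 := rPoly_eq_smul_R12 (U := z ^ 2 * w ^ 2) (V := 1) hq hq1 (mul_ne_zero hz hw)
    one_ne_zero (by ring) h2
  have hs : ∀ (c : ℂ) (M : Mat9), (c • M).submatrix Prod.swap Prod.swap =
      c • M.submatrix Prod.swap Prod.swap := fun c M => rfl
  rw [PolyReflection, e1, e2, hs, hs]
  simp only [Matrix.mul_smul, Matrix.smul_mul, smul_smul, R21]
  rw [mul_comm (z ^ 2 - w ^ 2)]
  exact (smul_right_inj (mul_ne_zero h2 h1)).symm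

/-! ### Generic points -/

section Generic

variable {D : Set ℂ}

theorem codiscreteWithin_neBot (hD : IsOpen D) (hD' : D.Nonempty) :
    (codiscreteWithin D).NeBot := by
  obtain ⟨x, hx⟩ := hD'
  have h : nhdsWithin x (D \ {x}) ≤ codiscreteWithin D := le_iSup₂_of_le x hx le_rfl
  refine Filter.NeBot.mono ?_ h
  rw [Set.sdiff_eq, nhdsWithin_inter_of_mem (nhdsWithin_le_nhds (hD.mem_nhds hx))]
  infer_instance

/-- Identity theorem: on a connected set, finite order at one point forces finite order everywhere,
and then the zeros are isolated. -/
theorem eventually_eq_zero_or_ne_zero (hD' : IsConnected D) {f : ℂ → ℂ}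
    (hf : MeromorphicOn f D) :
    (∀ᶠ z in codiscreteWithin D, f z = 0) ∨ ∀ᶠ z in codiscreteWithin D, f z ≠ 0 := by
  by_cases h : ∃ u ∈ D, meromorphicOrderAt f u ≠ ⊤
  · exact .inr (hf.eventually_codiscreteWithin_apply_ne_zero
      ((hf.exists_meromorphicOrderAt_ne_top_iff_forall_mem hD').1 h))
  · push Not at h
    refine .inl (mem_codiscreteWithin_iff_forall_mem_nhdsNE.2 fun x hx => ?_)
    filter_upwards [meromorphicOrderAt_eq_top_iff.1 (h x hx)] with z hz using .inl hz

theorem eventually_sq_ne (c : ℂ) : ∀ᶠ z in codiscreteWithin D, z ^ 2 ≠ c := by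
  obtain ⟨r, rfl⟩ := IsAlgClosed.exists_pow_nat_eq c two_pos
  filter_upwards [compl_finite_mem_codiscreteWithin (Set.toFinite {r, -r})] with z hz h
  exact hz (by simpa using sq_eq_sq_iff_eq_or_eq_neg.1 h)

end Generic

/-! ### The two families in coordinates -/

/-- The coordinates of `K_I`. -/
def coordsI (v : CoordI) (X : ℂ) : Coords where
  p := v.2 1 * (X ^ 2 - 1)
  s := v.2 0 * (X ^ 2 - 1)
  r := v.2 2 * (X ^ 2 - 1)
  P := v.1 1 * (X ^ 2 - 1)
  S := v.1 0 * (X ^ 2 - 1)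
  R := v.1 2 * (X ^ 2 - 1)
  u := v.2 3 * (X ^ 2 - 1)
  w := v.1 3 * (X ^ 2 - 1)
  f := v.1 4 * X - (v.2 4 - v.2 3) * X ^ 2 - v.1 3 * X ^ 3

/-- The coordinates of `K_II`. -/
noncomputable def coordsII (v : CoordII) (X : ℂ) : Coords where
  p := v.2 1 * (X ^ 2 - 1)
  s := 0
  r := -v.2 5 * (X ^ 2 - 1)
  P := v.2 0 * (X ^ 2 - 1) / X
  S := 0
  R := v.2 2 * (X ^ 2 - 1) / X
  u := v.2 3 * (X ^ 2 - 1)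
  w := v.2 4 * (X ^ 2 - 1) / X
  f := v.1 * X + (v.2 3 - v.2 4) * X ^ 2

theorem toMatrix_coordsI (v : CoordI) (z : ℂ) :
    (coordsI v (z ^ 2)).toMatrix (z ^ 2) = matrixI v z := by
  ext i j
  fin_cases i <;> fin_cases j <;>
    simp [coordsI, Coords.toMatrix, matrixI, -mul_eq_mul_left_iff] <;> ring

theorem toMatrix_coordsII (v : CoordII) {z : ℂ} (hz : z ≠ 0) :
    (coordsII v (z ^ 2)).toMatrix (z ^ 2) = matrixII v z := by
  ext i j
  fin_cases i <;> fin_cases j <;>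
    simp [coordsII, Coords.toMatrix, matrixII, -mul_eq_mul_left_iff] <;> field_simp <;> ring

/-- Each relation either becomes an identity or is (X - Y)(X² - 1)(Y² - 1) times quadrics from
`RelI`, with an additional factor XY when it involves f. -/
theorem exchange_coordsI {v : CoordI} (h : RelI v) (X Y : ℂ) :
    Exchange X Y (coordsI v X) (coordsI v Y) := by
  obtain ⟨h1, h2, h3, h4, h5, h6, h7, h8, h9, h10, h11, h12, h13, h14⟩ := h
  constructor <;> simp only [coordsI]
  case pP => linear_combination (X ^ 2 - 1) * (Y ^ 2 - 1) * (X - Y) * h1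
  case pR => linear_combination -(X ^ 2 - 1) * (Y ^ 2 - 1) * (X - Y) * h8
  case rP => linear_combination -(X ^ 2 - 1) * (Y ^ 2 - 1) * (X - Y) * h7
  case rR => linear_combination (X ^ 2 - 1) * (Y ^ 2 - 1) * (X - Y) * (h1 - h2)
  case uw => linear_combination (X ^ 2 - 1) * (Y ^ 2 - 1) * (X - Y) * h1
  case wp => linear_combination -(X ^ 2 - 1) * (Y ^ 2 - 1) * (X - Y) * h10
  case uP => linear_combination (X ^ 2 - 1) * (Y ^ 2 - 1) * (X - Y) * h9
  case fp => linear_combination X * Y * (X ^ 2 - 1) * (Y ^ 2 - 1) * (X - Y) * (h4 + Y * h10)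
  case fs => linear_combination X * Y * (X ^ 2 - 1) * (Y ^ 2 - 1) * (X - Y) * h6
  case fr => linear_combination X * Y * (X ^ 2 - 1) * (Y ^ 2 - 1) * (X - Y) * (-h14 - Y * h8)
  case fu => linear_combination X * Y * (X ^ 2 - 1) * (Y ^ 2 - 1) * (X - Y) * h11
  case fw => linear_combination X * Y * (X ^ 2 - 1) * (Y ^ 2 - 1) * (X - Y) * h12
  case fS => linear_combination X * Y * (X ^ 2 - 1) * (Y ^ 2 - 1) * (X - Y) * h5
  case fR => linear_combination -X * Y * (X ^ 2 - 1) * (Y ^ 2 - 1) * (X - Y) * h13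
  case fP => linear_combination X * Y * (X ^ 2 - 1) * (Y ^ 2 - 1) * (X - Y) * (h3 + Y * h9)
  all_goals ring

theorem exchange_coordsII {v : CoordII} (h : RelII v) {X Y : ℂ} (hX : X ≠ 0) (hY : Y ≠ 0) :
    Exchange X Y (coordsII v X) (coordsII v Y) := by
  obtain ⟨h1, h2, h3⟩ := h
  constructor <;> simp only [coordsII]
  case rR =>
    linear_combination (norm := (field_simp; ring))
      -(X ^ 2 - 1) * (Y ^ 2 - 1) * (X - Y) / X * h1
  case uw =>
    linear_combination (norm := (field_simp; ring))
      -(X ^ 2 - 1) * (Y ^ 2 - 1) * (X - Y) / X * h1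
  case wr =>
    linear_combination (norm := (field_simp; ring))
      (X ^ 2 - 1) * (Y ^ 2 - 1) * (1 / X - 1 / Y) * h2
  case uR =>
    linear_combination (norm := (field_simp; ring))
      (X ^ 2 - 1) * (Y ^ 2 - 1) * (1 / Y - 1 / X) * h3
  case fr =>
    linear_combination (norm := (field_simp; ring))
      (X ^ 2 - 1) * (Y ^ 2 - 1) * (X - Y) * Y ^ 2 * h2
  all_goals
    field_simp
    ring

/-- Multiplication of all coordinates by a scalar. -/
def Coords.scale (c : ℂ) (a : Coords) : Coords :=
  ⟨c * a.p, c * a.s, c * a.r, c * a.P, c * a.S, c * a.R, c * a.u, c * a.w, c * a.f⟩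

theorem Coords.toMatrix_scale (X c : ℂ) (a : Coords) :
    (a.scale c).toMatrix X = c • a.toMatrix X := by
  ext i j
  fin_cases i <;> fin_cases j <;> simp [Coords.scale, Coords.toMatrix] <;> ring

/-- The factorizations behind `exchange_coordsI` are read backwards: since X ≠ Y, the common factor
cancels. It is `hN` for quadrics from relations without f and `hM`, with the additional XY, for
those involving f. -/
theorem relI_of_exchange {X Y c d : ℂ} {v : CoordI} (hX : X ≠ 0) (hY : Y ≠ 0) (hd : X - Y ≠ 0)
    (hX1 : X ^ 2 - 1 ≠ 0) (hY1 : Y ^ 2 - 1 ≠ 0) (hc0 : c ≠ 0) (hd0 : d ≠ 0)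
    (h : Exchange X Y ((coordsI v X).scale c) ((coordsI v Y).scale d)) : RelI v := by
  have hN : c * d * (X ^ 2 - 1) * (Y ^ 2 - 1) * (X - Y) ≠ 0 :=
    mul_ne_zero (mul_ne_zero (mul_ne_zero (mul_ne_zero hc0 hd0) hX1) hY1) hd
  have hM := mul_ne_zero (mul_ne_zero hX hY) hN
  obtain ⟨-, -, -, -, -, -, -, -, -, -, -, -, -, -, -, -, -, -, -, pP, pR, rP, rR, -, wp, uP, -, -,
    fp, fs, fr, fu, fw, fS, fR, fP⟩ := h
  simp only [coordsI, Coords.scale] at pP pR rP rR wp uP fp fs fr fu fw fS fR fP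
  refine ⟨mul_left_cancel₀ hN ?_, mul_left_cancel₀ hN ?_, mul_left_cancel₀ hM ?_,
    mul_left_cancel₀ hM ?_, mul_left_cancel₀ hM ?_, mul_left_cancel₀ hM ?_, mul_left_cancel₀ hN ?_,
    mul_left_cancel₀ hN ?_, mul_left_cancel₀ hN ?_, mul_left_cancel₀ hN ?_,
    mul_left_cancel₀ hM ?_, mul_left_cancel₀ hM ?_, mul_left_cancel₀ hM ?_, mul_left_cancel₀ hM ?_⟩
  · linear_combination pP
  · linear_combination pP - rR
  · linear_combination fP - X * Y ^ 2 * uP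
  · linear_combination fp + X * Y ^ 2 * wp
  · linear_combination fS
  · linear_combination fs
  · linear_combination -rP
  · linear_combination -pR
  · linear_combination uP
  · linear_combination -wp
  · linear_combination fu
  · linear_combination fw
  · linear_combination -fR
  · linear_combination -fr + X * Y ^ 2 * pR

/-! ### Solutions with proportional coordinates -/

/-- All coordinates of `b` but the last are `k` times those of `a`. -/
def Coords.Proportional (k : ℂ) (a b : Coords) : Prop :=
  b.p = k * a.p ∧ b.s = k * a.s ∧ b.r = k * a.r ∧ b.P = k * a.P ∧ b.S = k * a.S ∧ b.R = k * a.R ∧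
    b.u = k * a.u ∧ b.w = k * a.w

/-- All coordinates but the last vanish. -/
def Coords.IsScalar (a : Coords) : Prop :=
  a.p = 0 ∧ a.s = 0 ∧ a.r = 0 ∧ a.P = 0 ∧ a.S = 0 ∧ a.R = 0 ∧ a.u = 0 ∧ a.w = 0

/-- The numbers c and d will be the projective coordinates a₄ and ā₄. The value of f at X gives one
linear equation for them; a second comes from the quadric of `RelI` that multiplies a nonzero
coordinate by c or d. The f-relation of that coordinate then determines f at every Y. Both numbers
depend only on X and `a`, so they serve all Y at once. -/
theorem exists_last_coordinate {X : ℂ} {a : Coords} (hX : X ≠ 0) (ha : ¬ a.IsScalar) :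
    ∃ c d : ℂ, (X ^ 2 - 1) * a.f = c * X - (d - a.u) * X ^ 2 - a.w * X ^ 3 ∧
      ∀ (Y k : ℂ) (b : Coords), Exchange X Y a b → a.Proportional k b →
        (Y ^ 2 - 1) * b.f = k * (c * Y - (d - a.u) * Y ^ 2 - a.w * Y ^ 3) := by
  -- The equation at X is solved for c when d is prescribed (nonzero p, r, S or u), and by `second`
  -- for d when c is prescribed (nonzero s, P, R or w).
  have first : ∀ e : ℂ, ∃ c, (X ^ 2 - 1) * a.f = c * X - (e - a.u) * X ^ 2 - a.w * X ^ 3 := fun e =>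
    ⟨((X ^ 2 - 1) * a.f + (e - a.u) * X ^ 2 + a.w * X ^ 3) / X, by field_simp; ring⟩
  have second : ∀ e : ℂ, ∃ d, (X ^ 2 - 1) * a.f = e * X - (d - a.u) * X ^ 2 - a.w * X ^ 3 := fun e =>
    ⟨(e * X - (X ^ 2 - 1) * a.f + a.u * X ^ 2 - a.w * X ^ 3) / X ^ 2, by field_simp; ring⟩
  have div : ∀ j e : ℂ, j ≠ 0 → j * (e / j) = e := fun j e hj => mul_div_cancel₀ e hj
  by_cases hp : a.p ≠ 0
  · obtain ⟨c, hc⟩ := first (a.s ^ 2 / a.p)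
    have he := div a.p (a.s ^ 2) hp
    refine ⟨c, _, hc, ?_⟩
    generalize a.s ^ 2 / a.p = d at *
    rintro Y k ⟨⟩ h ⟨rfl, rfl, rfl, rfl, rfl, rfl, rfl, rfl⟩
    refine mul_left_cancel₀ (mul_ne_zero hX hp) ?_
    linear_combination -h.fp + Y * k * a.p * hc - k * X * Y * (X - Y) * he - X * Y ^ 2 * h.wp
  by_cases hr : a.r ≠ 0
  · obtain ⟨c, hc⟩ := first (a.w * a.s / a.r)
    have he := div a.r (a.w * a.s) hr
    refine ⟨c, _, hc, ?_⟩
    generalize a.w * a.s / a.r = d at *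
    rintro Y k ⟨⟩ h ⟨rfl, rfl, rfl, rfl, rfl, rfl, rfl, rfl⟩
    refine mul_left_cancel₀ (mul_ne_zero hX hr) ?_
    linear_combination -h.fr + Y * k * a.r * hc - k * X * Y * (X - Y) * he + X * Y ^ 2 * h.pR
  by_cases hS : a.S ≠ 0
  · obtain ⟨c, hc⟩ := first (a.P * a.s / a.S)
    have he := div a.S (a.P * a.s) hS
    refine ⟨c, _, hc, ?_⟩
    generalize a.P * a.s / a.S = d at *
    rintro Y k ⟨⟩ h ⟨rfl, rfl, rfl, rfl, rfl, rfl, rfl, rfl⟩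
    refine mul_left_cancel₀ (mul_ne_zero hX hS) ?_
    linear_combination -h.fS + Y * k * a.S * hc - k * X * Y * (X - Y) * he
  by_cases hu : a.u ≠ 0
  · obtain ⟨c, hc⟩ := first (a.R * a.s / a.u)
    have he := div a.u (a.R * a.s) hu
    refine ⟨c, _, hc, ?_⟩
    generalize a.R * a.s / a.u = d at *
    rintro Y k ⟨⟩ h ⟨rfl, rfl, rfl, rfl, rfl, rfl, rfl, rfl⟩
    refine mul_left_cancel₀ (mul_ne_zero hX hu) ?_
    linear_combination -h.fu + Y * k * a.u * hc - k * X * Y * (X - Y) * he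
  by_cases hs : a.s ≠ 0
  · obtain ⟨d, hc⟩ := second (a.S * a.p / a.s)
    have he := div a.s (a.S * a.p) hs
    refine ⟨_, d, hc, ?_⟩
    generalize a.S * a.p / a.s = c at *
    rintro Y k ⟨⟩ h ⟨rfl, rfl, rfl, rfl, rfl, rfl, rfl, rfl⟩
    refine mul_left_cancel₀ (mul_ne_zero (pow_ne_zero 2 hX) hs) ?_
    linear_combination -h.fs + Y ^ 2 * k * a.s * hc - k * X * Y * (X - Y) * he
  by_cases hP : a.P ≠ 0
  · obtain ⟨d, hc⟩ := second (a.S ^ 2 / a.P)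
    have he := div a.P (a.S ^ 2) hP
    refine ⟨_, d, hc, ?_⟩
    generalize a.S ^ 2 / a.P = c at *
    rintro Y k ⟨⟩ h ⟨rfl, rfl, rfl, rfl, rfl, rfl, rfl, rfl⟩
    refine mul_left_cancel₀ (mul_ne_zero (pow_ne_zero 2 hX) hP) ?_
    linear_combination -h.fP + Y ^ 2 * k * a.P * hc - k * X * Y * (X - Y) * he + X * Y ^ 2 * h.uP
  by_cases hR : a.R ≠ 0
  · obtain ⟨d, hc⟩ := second (a.S * a.u / a.R)
    have he := div a.R (a.S * a.u) hR
    refine ⟨_, d, hc, ?_⟩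
    generalize a.S * a.u / a.R = c at *
    rintro Y k ⟨⟩ h ⟨rfl, rfl, rfl, rfl, rfl, rfl, rfl, rfl⟩
    refine mul_left_cancel₀ (mul_ne_zero (pow_ne_zero 2 hX) hR) ?_
    linear_combination -h.fR + Y ^ 2 * k * a.R * hc - k * X * Y * (X - Y) * he
  by_cases hw : a.w ≠ 0
  · obtain ⟨d, hc⟩ := second (a.S * a.r / a.w)
    have he := div a.w (a.S * a.r) hw
    refine ⟨_, d, hc, ?_⟩
    generalize a.S * a.r / a.w = c at *
    rintro Y k ⟨⟩ h ⟨rfl, rfl, rfl, rfl, rfl, rfl, rfl, rfl⟩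
    refine mul_left_cancel₀ (mul_ne_zero (pow_ne_zero 2 hX) hw) ?_
    linear_combination -h.fw + Y ^ 2 * k * a.w * hc - k * X * Y * (X - Y) * he
  push Not at hp hr hS hu hs hP hR hw
  exact absurd ⟨hp, hs, hr, hP, hS, hR, hu, hw⟩ ha

theorem exists_coordsI {X : ℂ} {a : Coords} (hX : X ≠ 0) (hX1 : X ^ 2 - 1 ≠ 0)
    (ha : ¬ a.IsScalar) :
    ∃ v : CoordI, ∀ (Y k : ℂ) (b : Coords), Y ≠ 0 → Y ^ 2 - 1 ≠ 0 → X - Y ≠ 0 → k ≠ 0 →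
      Exchange X Y a b → a.Proportional k b → RelI v ∧ ∃ h, b = (coordsI v Y).scale h := by
  obtain ⟨c, d, hc, H⟩ := exists_last_coordinate hX ha
  -- K_I carries a factor X² - 1 in its first eight coordinates, so `a` is the member with vector
  -- `v` scaled by (X² - 1)⁻¹.
  let v : CoordI := (![a.S, a.P, a.R, a.w, c], ![a.s, a.p, a.r, a.u, d])
  have ha : a = (coordsI v X).scale (X ^ 2 - 1)⁻¹ := by
    rcases a with ⟨⟩
    simp only [v, coordsI, Coords.scale, Coords.mk.injEq]
    simp at hc ⊢
    refine ⟨?_, ?_, ?_, ?_, ?_, ?_, ?_, ?_, ?_⟩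
    all_goals field_simp
    linear_combination hc
  refine ⟨v, fun Y k b hY hY1 hd hk h hb => ?_⟩
  have hf := H Y k b h hb
  have hb' : b = (coordsI v Y).scale (k * (Y ^ 2 - 1)⁻¹) := by
    rcases b with ⟨⟩
    obtain ⟨h1, h2, h3, h4, h5, h6, h7, h8⟩ := hb
    simp only [v, coordsI, Coords.scale, Coords.mk.injEq]
    simp at hf h1 h2 h3 h4 h5 h6 h7 h8 ⊢
    refine ⟨?_, ?_, ?_, ?_, ?_, ?_, ?_, ?_, ?_⟩
    all_goals field_simp
    all_goals first | assumption | linear_combination hf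
  refine ⟨?_, _, hb'⟩
  rw [hb'] at h
  exact relI_of_exchange hX hY hd hX1 hY1 (inv_ne_zero hX1) (mul_ne_zero hk (inv_ne_zero hY1))
    (ha ▸ h)

/-- The coordinates of `b` at `Y` are those of `a` at `X`, up to the factor `k` and the dependence
of the coordinates of `K_II` on `z`. -/
def Coords.ProportionalII (X : ℂ) (a : Coords) (Y : ℂ) (b : Coords) (k : ℂ) : Prop :=
  b.p = k * a.p ∧ b.r = k * a.r ∧ b.u = k * a.u ∧ Y * b.P = k * (X * a.P) ∧
    Y * b.R = k * (X * a.R) ∧ Y * b.w = k * (X * a.w) ∧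
    X * (Y ^ 2 - 1) * b.f = k * (Y * (X ^ 2 - 1) * a.f + X * Y * (X - Y) * (X * a.w - a.u))

/-- The vector is built from `a` alone. Solving (X² - 1)f = bX + (u - Xw)X² for b gives its first
component; the last clause of `Coords.ProportionalII` says precisely that this quantity is
multiplied by k, like the others. -/
theorem exists_coordsII {X : ℂ} {a : Coords} (hX : X ≠ 0) (hs : a.s = 0) :
    ∃ v : CoordII, ∀ (Y k : ℂ) (b : Coords), Y ≠ 0 → Y ^ 2 - 1 ≠ 0 → X - Y ≠ 0 → k ≠ 0 →
      Exchange X Y a b → b.s = 0 → b.S = 0 → a.ProportionalII X Y b k →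
      RelII v ∧ ∃ h, b = (coordsII v Y).scale h := by
  refine ⟨((X ^ 2 - 1) * a.f / X + X * (X * a.w - a.u), ![X * a.P, a.p, X * a.R, a.u, X * a.w,
    -a.r]), fun Y k b hY hY1 hd hk h hs' hS'
      ⟨hp, hr, hu, hP, hR, hw, hf⟩ => ⟨?_, k * (Y ^ 2 - 1)⁻¹, ?_⟩⟩
  · have e1 := h.rR
    have e2 := h.wr
    have e3 := h.uR
    rw [hp, hr, hu, hs, hS'] at *
    have hkd := mul_ne_zero hk hd
    refine ⟨mul_left_cancel₀ hkd ?_, mul_left_cancel₀ hkd ?_, mul_left_cancel₀ hkd ?_⟩ <;>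
      simp [-mul_eq_zero, -mul_eq_mul_left_iff]
    · linear_combination -X * e1 + X * a.r * hR
    · linear_combination -X * Y * e2 - X * a.r * hw - X * a.p * hR
    · linear_combination X * Y * e3 - X * a.u * hR - X * a.r * hP
  · rcases b with ⟨⟩
    simp only [coordsII, Coords.scale, Coords.mk.injEq]
    simp at hf hs' hS' hp hr hu hP hR hw ⊢
    refine ⟨?_, hs', ?_, ?_, hS', ?_, ?_, ?_, ?_⟩
    all_goals field_simp
    · exact hp
    · exact hr
    · linear_combination hP
    · linear_combination hR
    · exact hu
    · linear_combination hw
    · linear_combination hf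

/-! ### Proportionality forced by a single nonzero coordinate -/

namespace Exchange

variable {X Y : ℂ} {a b : Coords}

theorem proportional_of_s (h : Exchange X Y a b) (ha : a.s ≠ 0) :
    a.Proportional (b.s / a.s) b := by
  refine ⟨?_, ?_, ?_, ?_, ?_, ?_, ?_, ?_⟩ <;> field_simp
  exacts [by linear_combination h.sp, by linear_combination h.sr, by linear_combination h.sP,
    by linear_combination h.sS, by linear_combination h.sR, by linear_combination h.su,
    by linear_combination h.sw]

theorem proportional_of_S (h : Exchange X Y a b) (ha : a.S ≠ 0) :
    a.Proportional (b.S / a.S) b := by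
  refine ⟨?_, ?_, ?_, ?_, ?_, ?_, ?_, ?_⟩ <;> field_simp
  exacts [by linear_combination h.Sp, by linear_combination -h.sS, by linear_combination h.Sr,
    by linear_combination h.SP, by linear_combination h.SR, by linear_combination h.Su,
    by linear_combination h.Sw]

/-- Once s, S, p, P vanish, the correction terms of `uw` and `uR` disappear and they become plain
commutators, so u can serve as a pivot. -/
theorem proportional_of_u (h : Exchange X Y a b) (hY : Y ≠ 0) (ha : a.u ≠ 0)
    (hs : a.s = 0) (hS : a.S = 0) (hp : a.p = 0) (hP : a.P = 0)
    (hs' : b.s = 0) (hS' : b.S = 0) (hp' : b.p = 0) (hP' : b.P = 0) :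
    a.Proportional (b.u / a.u) b := by
  have h1 := h.uR
  have h2 := h.uw
  rw [hs, hP] at h2
  rw [hP, hP'] at h1
  refine ⟨by rw [hp, hp', mul_zero], by rw [hs, hs', mul_zero], ?_, by rw [hP, hP', mul_zero],
    by rw [hS, hS', mul_zero], ?_, ?_, ?_⟩ <;> field_simp
  · linear_combination -h.ru
  · linear_combination h1
  · exact mul_left_cancel₀ hY (by linear_combination h2)

theorem proportional_of_w (h : Exchange X Y a b) (hY : Y ≠ 0) (ha : a.w ≠ 0)
    (hs : a.s = 0) (hS : a.S = 0) (hp : a.p = 0) (hP : a.P = 0)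
    (hs' : b.s = 0) (hS' : b.S = 0) (hp' : b.p = 0) (hP' : b.P = 0) :
    a.Proportional (b.w / a.w) b := by
  have h1 := h.wr
  have h2 := h.uw
  rw [hs, hP] at h2
  rw [hp, hp'] at h1
  refine ⟨by rw [hp, hp', mul_zero], by rw [hs, hs', mul_zero], ?_, by rw [hP, hP', mul_zero],
    by rw [hS, hS', mul_zero], ?_, ?_, ?_⟩ <;> field_simp
  · linear_combination h1
  · linear_combination h.wR
  · exact mul_left_cancel₀ hY (by linear_combination -h2)

/-- With s = 0 the relations `pP`, `pR`, `wp` reduce to two terms weighted by X and Y, such as Y a.p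
b.R = X a.R b.p. Hence XP, XR and Xw, rather than P, R and w, keep a constant ratio to p; `fp`
controls f. -/
theorem proportionalII_of_p (h : Exchange X Y a b) (ha : a.p ≠ 0)
    (hs : a.s = 0) (hs' : b.s = 0) :
    a.ProportionalII X Y b (b.p / a.p) := by
  have h1 := h.pP
  have h2 := h.pR
  have h3 := h.wp
  have h4 := h.fp
  rw [hs'] at h2 h4
  rw [hs] at h1 h3
  refine ⟨?_, ?_, ?_, ?_, ?_, ?_, ?_⟩ <;> field_simp
  · linear_combination h.pr
  · linear_combination h.pu
  · linear_combination h1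
  · linear_combination -h2
  · linear_combination -h3
  · linear_combination -h4

theorem proportionalII_of_P (h : Exchange X Y a b) (hX : X ≠ 0) (hY : Y ≠ 0) (ha : a.P ≠ 0)
    (hs : a.s = 0) (hS : a.S = 0) (hS' : b.S = 0) :
    a.ProportionalII X Y b (Y * b.P / (X * a.P)) := by
  have h1 := h.pP
  have h2 := h.rP
  have h3 := h.uP
  have h4 := h.fP
  rw [hs] at h1
  rw [hS'] at h2
  rw [hS] at h3 h4
  rw [hS'] at h4
  refine ⟨?_, ?_, ?_, ?_, ?_, ?_, ?_⟩ <;> field_simp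
  · linear_combination -h1
  · linear_combination h2
  · linear_combination -h3
  · linear_combination -h.RP
  · linear_combination -h.wP
  · linear_combination -h4

/-- With everything but r, R and f equal to zero, `rR` ties XR to r and `fr` ties f to r. -/
theorem proportionalII_of_r (h : Exchange X Y a b) (ha : a.r ≠ 0)
    (hs : a.s = 0) (hp : a.p = 0) (hP : a.P = 0) (hu : a.u = 0) (hw : a.w = 0)
    (hp' : b.p = 0) (hP' : b.P = 0) (hu' : b.u = 0) (hw' : b.w = 0) :
    a.ProportionalII X Y b (b.r / a.r) := by
  have h1 := h.rR
  have h2 := h.fr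
  rw [hs, hP, hw] at h1
  rw [hp', hw, hu] at h2
  refine ⟨by rw [hp, hp', mul_zero], ?_, by rw [hu, hu', mul_zero],
    by rw [hP, hP', mul_zero, mul_zero, mul_zero], ?_,
    by rw [hw, hw', mul_zero, mul_zero, mul_zero], ?_⟩ <;> (try rw [hu, hw]) <;> field_simp
  · linear_combination h1
  · linear_combination -h2

theorem proportionalII_of_R (h : Exchange X Y a b) (hX : X ≠ 0) (ha : a.R ≠ 0)
    (hs : a.s = 0) (hp : a.p = 0) (hP : a.P = 0) (hu : a.u = 0) (hw : a.w = 0)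
    (hp' : b.p = 0) (hP' : b.P = 0) (hu' : b.u = 0) (hw' : b.w = 0) :
    a.ProportionalII X Y b (Y * b.R / (X * a.R)) := by
  have h1 := h.rR
  have h2 := h.fR
  rw [hs, hP, hw] at h1
  rw [hu', hw, hu] at h2
  refine ⟨by rw [hp, hp', mul_zero], ?_, by rw [hu, hu', mul_zero],
    by rw [hP, hP', mul_zero, mul_zero, mul_zero], ?_,
    by rw [hw, hw', mul_zero, mul_zero, mul_zero], ?_⟩ <;> (try rw [hu, hw]) <;> field_simp
  · linear_combination -h1
  · linear_combination -h2

end Exchange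

theorem Coords.IsScalar.proportionalII {X Y : ℂ} {a b : Coords} (h : a.IsScalar)
    (h' : b.IsScalar) (hX1 : X ^ 2 - 1 ≠ 0) (hY : Y ≠ 0) (ha : a.f ≠ 0) :
    a.ProportionalII X Y b (X * (Y ^ 2 - 1) * b.f / (Y * (X ^ 2 - 1) * a.f)) := by
  obtain ⟨hp, hs, hr, hP, hS, hR, hu, hw⟩ := h
  obtain ⟨hp', hs', hr', hP', hS', hR', hu', hw'⟩ := h'
  refine ⟨?_, ?_, ?_, ?_, ?_, ?_, ?_⟩ <;>
    simp only [hp, hr, hP, hR, hu, hw, hp', hr', hP', hR', hu', hw', mul_zero]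
  field_simp
  ring


/-! ### Classification of the solutions -/

section Classification

variable {D : Set ℂ} {K : ℂ → Mat3}

theorem eventually_generic (D : Set ℂ) :
    ∀ᶠ w in codiscreteWithin D, w ^ 2 ≠ 0 ∧ (w ^ 2) ^ 2 - 1 ≠ 0 := by
  filter_upwards [eventually_sq_ne (D := D) 0, eventually_sq_ne (D := D) 1,
    eventually_sq_ne (D := D) (-1)] with w h0 h1 h2
  refine ⟨h0, fun h => ?_⟩
  rcases mul_eq_zero.1 (show (w ^ 2 - 1) * (w ^ 2 - -1) = 0 by linear_combination h) with h | h
  · exact h1 (sub_eq_zero.1 h)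
  · exact h2 (sub_eq_zero.1 h)

/-- The vector is extracted at the single point z and does not depend on w. `RelI` needs only one
admissible w, which exists because the filter is nontrivial. -/
theorem eventually_eq_smul_matrixI (hl : (codiscreteWithin D).NeBot) {z : ℂ} (hz0 : z ^ 2 ≠ 0)
    (hz1 : (z ^ 2) ^ 2 - 1 ≠ 0) (ha : ¬ (coords (z ^ 2) (K z)).IsScalar)
    (H : ∀ᶠ w in codiscreteWithin D,
      Exchange (z ^ 2) (w ^ 2) (coords (z ^ 2) (K z)) (coords (w ^ 2) (K w)) ∧ ∃ k : ℂ, k ≠ 0 ∧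
        (coords (z ^ 2) (K z)).Proportional k (coords (w ^ 2) (K w))) :
    ∃ v, RelI v ∧ ∀ᶠ w in codiscreteWithin D, ∃ h : ℂ, K w = h • matrixI v w := by
  obtain ⟨v, hv⟩ := exists_coordsI hz0 hz1 ha
  have H' : ∀ᶠ w in codiscreteWithin D, RelI v ∧ ∃ h : ℂ, K w = h • matrixI v w := by
    filter_upwards [H, eventually_generic D, eventually_sq_ne (z ^ 2)]
      with w ⟨hE, k, hk, hp⟩ ⟨hw0, hw1⟩ hzw
    obtain ⟨hR, h, hh⟩ := hv _ _ _ hw0 hw1 (sub_ne_zero.2 hzw.symm) hk hE hp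
    refine ⟨hR, h, ?_⟩
    rw [← toMatrix_coords hw0 (K w), hh, Coords.toMatrix_scale, toMatrix_coordsI]
  obtain ⟨w, hw⟩ := H'.exists
  exact ⟨v, hw.1, H'.mono fun _ h => h.2⟩

theorem eventually_eq_smul_matrixII (hl : (codiscreteWithin D).NeBot) {z : ℂ} (hz0 : z ^ 2 ≠ 0)
    (hs0 : ∀ᶠ w in codiscreteWithin D, (coords (w ^ 2) (K w)).s = 0)
    (hS0 : ∀ᶠ w in codiscreteWithin D, (coords (w ^ 2) (K w)).S = 0)
    (hz : (coords (z ^ 2) (K z)).s = 0)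
    (H : ∀ᶠ w in codiscreteWithin D,
      Exchange (z ^ 2) (w ^ 2) (coords (z ^ 2) (K z)) (coords (w ^ 2) (K w)) ∧ ∃ k : ℂ, k ≠ 0 ∧
        (coords (z ^ 2) (K z)).ProportionalII (z ^ 2) (w ^ 2) (coords (w ^ 2) (K w)) k) :
    ∃ v, RelII v ∧ ∀ᶠ w in codiscreteWithin D, ∃ h : ℂ, K w = h • matrixII v w := by
  obtain ⟨v, hv⟩ := exists_coordsII hz0 hz
  have H' : ∀ᶠ w in codiscreteWithin D, RelII v ∧ ∃ h : ℂ, K w = h • matrixII v w := by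
    filter_upwards [H, eventually_generic D, eventually_sq_ne (z ^ 2), hs0, hS0]
      with w ⟨hE, k, hk, hp⟩ ⟨hw0, hw1⟩ hzw hs hS
    obtain ⟨hR, h, hh⟩ := hv _ k _ hw0 hw1 (sub_ne_zero.2 hzw.symm) hk hE hs hS hp
    refine ⟨hR, h, ?_⟩
    rw [← toMatrix_coords hw0 (K w), hh, Coords.toMatrix_scale,
      toMatrix_coordsII v (by rintro rfl; simp at hw0)]
  obtain ⟨w, hw⟩ := H'.exists
  exact ⟨v, hw.1, H'.mono fun _ h => h.2⟩

/-- The pivots are tried in the order s, S, p, P, u, w, r, R, f. The order is essential: a later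
pivot works because the vanishing of earlier ones removes the correction terms from its relations.
-/
theorem exists_eq_smul_matrix (hD : IsOpen D) (hD' : IsConnected D) (hK : K ∈ meroMatrices D)
    (hK0 : ¬ MeroEq D K 0)
    (hE : ∀ᶠ z in codiscreteWithin D, ∀ᶠ w in codiscreteWithin D,
      Exchange (z ^ 2) (w ^ 2) (coords (z ^ 2) (K z)) (coords (w ^ 2) (K w))) :
    (∃ v, RelI v ∧ ∀ᶠ w in codiscreteWithin D, ∃ h : ℂ, K w = h • matrixI v w) ∨
      ∃ v, RelII v ∧ ∀ᶠ w in codiscreteWithin D, ∃ h : ℂ, K w = h • matrixII v w := by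
  have hl := codiscreteWithin_neBot hD hD'.nonempty
  have hsq : MeromorphicOn (fun z : ℂ => z ^ 2) D := MeromorphicOn.id.fun_pow 2
  have hg := eventually_generic D
  have dich := fun f (hf : MeromorphicOn f D) => eventually_eq_zero_or_ne_zero hD' hf
  have hEg := hE.and hg
  rcases dich (fun z => (coords (z ^ 2) (K z)).s) ((hK 2 1).fun_div hsq) with s0 | s0
  swap
  · obtain ⟨z, ⟨hz, hz0, hz1⟩, hs⟩ := (hEg.and s0).exists
    refine .inl (eventually_eq_smul_matrixI hl hz0 hz1 (fun h => hs h.2.1) ?_)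
    filter_upwards [hz, s0] with w h hw using ⟨h, _, div_ne_zero hw hs, h.proportional_of_s hs⟩
  rcases dich (fun z => (coords (z ^ 2) (K z)).S) (hK 0 1) with S0 | S0
  swap
  · obtain ⟨z, ⟨hz, hz0, hz1⟩, hS⟩ := (hEg.and S0).exists
    refine .inl (eventually_eq_smul_matrixI hl hz0 hz1 (fun h => hS h.2.2.2.2.1) ?_)
    filter_upwards [hz, S0] with w h hw using ⟨h, _, div_ne_zero hw hS, h.proportional_of_S hS⟩
  have hsS := s0.and S0
  rcases dich (fun z => (coords (z ^ 2) (K z)).p) (hK 2 0) with p0 | p0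
  swap
  · obtain ⟨z, ⟨⟨hz, hz0, hz1⟩, hp⟩, hs, hS⟩ := ((hEg.and p0).and hsS).exists
    refine .inr (eventually_eq_smul_matrixII hl hz0 s0 S0 hs ?_)
    filter_upwards [hz, p0, s0] with w h hw hs'
      using ⟨h, _, div_ne_zero hw hp, h.proportionalII_of_p hp hs hs'⟩
  rcases dich (fun z => (coords (z ^ 2) (K z)).P) ((hK 0 2).fun_div hsq) with P0 | P0
  swap
  · obtain ⟨z, ⟨⟨hz, hz0, hz1⟩, hP⟩, hs, hS⟩ := ((hEg.and P0).and hsS).exists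
    refine .inr (eventually_eq_smul_matrixII hl hz0 s0 S0 hs ?_)
    filter_upwards [hz, P0, S0, hg] with w h hw hS' hw0
      using ⟨h, _, div_ne_zero (mul_ne_zero hw0.1 hw) (mul_ne_zero hz0 hP),
        h.proportionalII_of_P hz0 hw0.1 hP hs hS hS'⟩
  have hpP := p0.and P0
  have h4 := hsS.and hpP
  rcases dich (fun z => (coords (z ^ 2) (K z)).u) ((hK 1 1).fun_sub (hK 0 0)) with u0 | u0
  swap
  · obtain ⟨z, ⟨⟨hz, hz0, hz1⟩, hu⟩, ⟨hs, hS⟩, hp, hP⟩ := ((hEg.and u0).and h4).exists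
    refine .inl (eventually_eq_smul_matrixI hl hz0 hz1 (fun h => hu h.2.2.2.2.2.2.1) ?_)
    filter_upwards [hz, u0, hg, h4] with w h hw hw0 ⟨⟨hs', hS'⟩, hp', hP'⟩
      using ⟨h, _, div_ne_zero hw hu,
        h.proportional_of_u hw0.1 hu hs hS hp hP hs' hS' hp' hP'⟩
  rcases dich (fun z => (coords (z ^ 2) (K z)).w) (((hK 1 1).fun_sub (hK 2 2)).fun_div hsq)
    with w0 | w0
  swap
  · obtain ⟨z, ⟨⟨hz, hz0, hz1⟩, hw⟩, ⟨hs, hS⟩, hp, hP⟩ := ((hEg.and w0).and h4).exists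
    refine .inl (eventually_eq_smul_matrixI hl hz0 hz1 (fun h => hw h.2.2.2.2.2.2.2) ?_)
    filter_upwards [hz, w0, hg, h4] with w h hw' hw0 ⟨⟨hs', hS'⟩, hp', hP'⟩
      using ⟨h, _, div_ne_zero hw' hw,
        h.proportional_of_w hw0.1 hw hs hS hp hP hs' hS' hp' hP'⟩
  have h6 := h4.and (u0.and w0)
  rcases dich (fun z => (coords (z ^ 2) (K z)).r) ((hK 1 0).fun_sub (hK 2 1)) with r0 | r0
  swap
  · obtain ⟨z, ⟨⟨hz, hz0, hz1⟩, hr⟩, ⟨⟨hs, hS⟩, hp, hP⟩, hu, hw⟩ := ((hEg.and r0).and h6).exists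
    refine .inr (eventually_eq_smul_matrixII hl hz0 s0 S0 hs ?_)
    filter_upwards [hz, r0, h6] with w h hr' ⟨⟨_, hp', hP'⟩, hu', hw'⟩
      using ⟨h, _, div_ne_zero hr' hr, h.proportionalII_of_r hr hs hp hP hu hw hp' hP' hu' hw'⟩
  rcases dich (fun z => (coords (z ^ 2) (K z)).R) (((hK 1 2).fun_sub (hK 0 1)).fun_div hsq)
    with R0 | R0
  swap
  · obtain ⟨z, ⟨⟨hz, hz0, hz1⟩, hR⟩, ⟨⟨hs, hS⟩, hp, hP⟩, hu, hw⟩ := ((hEg.and R0).and h6).exists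
    refine .inr (eventually_eq_smul_matrixII hl hz0 s0 S0 hs ?_)
    filter_upwards [hz, R0, h6, hg] with w h hR' ⟨⟨_, hp', hP'⟩, hu', hw'⟩ hw0
      using ⟨h, _, div_ne_zero (mul_ne_zero hw0.1 hR') (mul_ne_zero hz0 hR),
        h.proportionalII_of_R hz0 hR hs hp hP hu hw hp' hP' hu' hw'⟩
  -- Only f is left, so K is a multiple of the identity: the member of K_II whose only nonzero
  -- coordinate is b.
  have scalar : ∀ᶠ w in codiscreteWithin D, (coords (w ^ 2) (K w)).IsScalar := by
    filter_upwards [h6, r0, R0] with w ⟨⟨⟨hs, hS⟩, hp, hP⟩, hu, hw⟩ hr hR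
      using ⟨hp, hs, hr, hP, hS, hR, hu, hw⟩
  rcases dich (fun z => (coords (z ^ 2) (K z)).f) (hK 2 2) with f0 | f0
  · refine absurd ?_ hK0
    filter_upwards [scalar, f0, hg] with w ⟨hp, hs, hr, hP, hS, hR, hu, hw⟩ hf hw0
    rw [← toMatrix_coords hw0.1 (K w), Coords.toMatrix, hp, hs, hr, hP, hS, hR, hu, hw, hf]
    ext i j
    fin_cases i <;> fin_cases j <;> simp
  · obtain ⟨z, ⟨⟨hz, hz0, hz1⟩, hf⟩, ha⟩ := ((hEg.and f0).and scalar).exists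
    refine .inr (eventually_eq_smul_matrixII hl hz0 s0 S0 ha.2.1 ?_)
    filter_upwards [hz, f0, scalar, hg] with w h hf' hb hw0
      using ⟨h, _, div_ne_zero (mul_ne_zero (mul_ne_zero hz0 hw0.2) hf')
        (mul_ne_zero (mul_ne_zero hw0.1 hz1) hf), ha.proportionalII hb hz1 hw0.1 hf⟩

end Classification

/-! ### The solution space -/

section SolutionSpace

variable {D : Set ℂ} {K : ℂ → Mat3} {q : ℂ}

theorem reflectionEquation_iff (hq : q ≠ 0) (hq1 : q ^ 2 ≠ 1) :
    ReflectionEquation q D K ↔ ∀ᶠ z in codiscreteWithin D, ∀ᶠ w in codiscreteWithin D,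
      PolyReflection (z ^ 2) (w ^ 2) (1 / (q ^ 2 - 1)) (K z) (K w) := by
  have H : ∀ᶠ z in codiscreteWithin D, ∀ᶠ w in codiscreteWithin D,
      z ≠ 0 ∧ w ≠ 0 ∧ z ^ 2 - w ^ 2 ≠ 0 ∧ z ^ 2 * w ^ 2 - 1 ≠ 0 := by
    filter_upwards [eventually_generic D] with z hz
    filter_upwards [eventually_generic D, eventually_sq_ne (z ^ 2), eventually_sq_ne (z ^ 2)⁻¹]
      with w hw h1 h2
    refine ⟨fun h => hz.1 (by simp [h]), fun h => hw.1 (by simp [h]), sub_ne_zero.2 h1.symm,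
      fun h => h2 (eq_inv_of_mul_eq_one_right (sub_eq_zero.1 h))⟩
  refine eventually_congr (H.mono fun z hz => eventually_congr (hz.mono fun w hw => ?_))
  exact polyReflection_iff hq hq1 hw.1 hw.2.1 hw.2.2.1 hw.2.2.2 _ _

theorem exchange_of_reflectionEquation (hq : q ≠ 0) (hq1 : q ^ 2 ≠ 1)
    (h : ReflectionEquation q D K) :
    ∀ᶠ z in codiscreteWithin D, ∀ᶠ w in codiscreteWithin D,
      Exchange (z ^ 2) (w ^ 2) (coords (z ^ 2) (K z)) (coords (w ^ 2) (K w)) := by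
  have h1 : q ^ 2 - 1 ≠ 0 := sub_ne_zero.2 hq1
  filter_upwards [(reflectionEquation_iff hq hq1).1 h, eventually_generic D] with z hz hz0
  filter_upwards [hz, eventually_generic D, eventually_sq_ne (z ^ 2)⁻¹] with w hw hw0 h2
  refine exchange_of_polyReflection hz0.1 hw0.1 hw0.2
    (fun h => h2 (eq_inv_of_mul_eq_one_right (sub_eq_zero.1 h))) (one_div_ne_zero h1) ?_
    (by rwa [toMatrix_coords hz0.1, toMatrix_coords hw0.1])
  -- This is where q ≠ 0 makes the pivot 1 + t nonzero.
  rw [show 1 + 1 / (q ^ 2 - 1) = q ^ 2 / (q ^ 2 - 1) by field_simp; ring]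
  exact div_ne_zero (pow_ne_zero 2 hq) h1

/-- The pointwise factors c need not vary meromorphically as given. Dividing corresponding entries
of K and L, at a position where L is generically nonzero, recovers them as one meromorphic function.
-/
theorem eqUpToFactor_of_eventually (hD' : IsConnected D)
    {L : ℂ → Mat3} (hK : K ∈ meroMatrices D) (hK0 : ¬ MeroEq D K 0) (hL : L ∈ meroMatrices D)
    (h : ∀ᶠ w in codiscreteWithin D, ∃ c : ℂ, K w = c • L w) : EqUpToFactor D K L := by
  obtain ⟨i, j, hij⟩ : ∃ i j, ∀ᶠ w in codiscreteWithin D, L w i j ≠ 0 := by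
    by_contra! H
    refine hK0 ?_
    have h0 : ∀ i j, ∀ᶠ w in codiscreteWithin D, L w i j = 0 := fun i j =>
      (eventually_eq_zero_or_ne_zero hD' (hL i j)).resolve_right (H i j)
    filter_upwards [h, eventually_all.2 fun i => eventually_all.2 (h0 i)] with w ⟨c, hc⟩ hw
    ext i j
    simp [hc, hw]
  have hf : ∀ᶠ w in codiscreteWithin D, K w = (K w i j / L w i j) • L w := by
    filter_upwards [h, hij] with w ⟨c, hc⟩ hw
    rw [hc, Matrix.smul_apply, smul_eq_mul, mul_div_cancel_right₀ _ hw]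
  refine ⟨fun w => K w i j / L w i j, (hK i j).fun_div (hL i j), fun h0 => hK0 ?_, hf⟩
  filter_upwards [hf, h0] with w hw h0
  rw [hw, h0]
  simp

theorem matrixI_mem_meroMatrices (v : CoordI) : matrixI v ∈ meroMatrices D := by
  have hd : ∀ i j, Differentiable ℂ fun z => matrixI v z i j := by
    intro i j
    fin_cases i <;> fin_cases j <;> simp [matrixI] <;> fun_prop
  exact fun i j z _ => ((hd i j).analyticAt z).meromorphicAt

theorem matrixII_mem_meroMatrices (v : CoordII) : matrixII v ∈ meroMatrices D := by
  have hd : ∀ i j, Differentiable ℂ fun z => matrixII v z i j := by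
    intro i j
    fin_cases i <;> fin_cases j <;> simp [matrixII] <;> fun_prop
  exact fun i j z _ => ((hd i j).analyticAt z).meromorphicAt

theorem EqUpToFactor.smul {L : ℂ → Mat3} (h : EqUpToFactor D K L) {c : ℂ} (hc : c ≠ 0) :
    EqUpToFactor D K (fun z => c • L z) := by
  obtain ⟨f, hf, hf0, hKL⟩ := h
  refine ⟨fun z => f z * c⁻¹, hf.fun_mul (.const _), fun h => hf0 ?_, ?_⟩
  · filter_upwards [h] with z hz
    exact (mul_eq_zero.1 hz).resolve_right (inv_ne_zero hc)
  · filter_upwards [hKL] with z hz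
    rw [hz, smul_smul, mul_assoc, inv_mul_cancel₀ hc, mul_one]

theorem mem_spaceI_of_eqUpToFactor (hK : K ∈ meroMatrices D) {v : CoordI} (hv : v ≠ 0)
    (hR : RelI v) (h : EqUpToFactor D K (matrixI v)) : K ∈ spaceI D := by
  refine ⟨hK, Projectivization.mk ℂ v hv, (mk_mem_varietyI v hv).2 hR, ?_⟩
  obtain ⟨c, hc⟩ := Projectivization.exists_smul_eq_mk_rep ℂ v hv
  have hc' : (c : ℂ) • v = (Projectivization.mk ℂ v hv).rep := hc
  rw [← hc', funext (matrixI_smul (c : ℂ) v)]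
  exact h.smul c.ne_zero

theorem mem_spaceII_of_eqUpToFactor (hK : K ∈ meroMatrices D) {v : CoordII} (hv : v ≠ 0)
    (hR : RelII v) (h : EqUpToFactor D K (matrixII v)) : K ∈ spaceII D := by
  refine ⟨hK, Projectivization.mk ℂ v hv, (mk_mem_varietyII v hv).2 hR, ?_⟩
  obtain ⟨c, hc⟩ := Projectivization.exists_smul_eq_mk_rep ℂ v hv
  have hc' : (c : ℂ) • v = (Projectivization.mk ℂ v hv).rep := hc
  rw [← hc', funext (matrixII_smul (c : ℂ) v)]
  exact h.smul c.ne_zero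

theorem solutionSpace_subset (hD : IsOpen D) (hD' : IsConnected D) (hq : q ≠ 0)
    (hq1 : q ^ 2 ≠ 1) : solutionSpace q D ⊆ spaceI D ∪ spaceII D := by
  rintro K ⟨hK, hK0, hE⟩
  rcases exists_eq_smul_matrix hD hD' hK hK0 (exchange_of_reflectionEquation hq hq1 hE)
    with ⟨v, hR, hv⟩ | ⟨v, hR, hv⟩
  · refine .inl (mem_spaceI_of_eqUpToFactor hK ?_ hR
      (eqUpToFactor_of_eventually hD' hK hK0 (matrixI_mem_meroMatrices v) hv))
    rintro rfl
    refine hK0 (hv.mono fun w ⟨c, hc⟩ => ?_)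
    have := matrixI_smul 0 0 w
    rw [smul_zero, zero_smul] at this
    rw [hc, this, smul_zero, Pi.zero_apply]
  · refine .inr (mem_spaceII_of_eqUpToFactor hK ?_ hR
      (eqUpToFactor_of_eventually hD' hK hK0 (matrixII_mem_meroMatrices v) hv))
    rintro rfl
    refine hK0 (hv.mono fun w ⟨c, hc⟩ => ?_)
    have := matrixII_smul 0 0 w
    rw [smul_zero, zero_smul] at this
    rw [hc, this, smul_zero, Pi.zero_apply]

/-- A nonzero coordinate vector gives a matrix `K_I` that is not identically zero. -/
theorem not_meroEq_matrixI (hD : IsOpen D) (hD' : IsConnected D) {v : CoordI} (hv : v ≠ 0) :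
    ¬ MeroEq D (matrixI v) 0 := by
  intro h
  have hl := codiscreteWithin_neBot hD hD'.nonempty
  obtain ⟨z, hz, hz0, hz1⟩ := (h.and (eventually_generic D)).exists
  -- One point is not enough: if only a₄ and ā₄ are nonzero, the matrix is (a₄z² - ā₄z⁴) Id, which
  -- may vanish at z. A second point with w² ≠ z² separates the two.
  obtain ⟨w, ⟨hw, hw0, hw1⟩, hzw⟩ :=
    ((h.and (eventually_generic D)).and (eventually_sq_ne (z ^ 2))).exists
  have e : ∀ i j, matrixI v z i j = 0 := fun i j => by rw [hz]; rfl
  have e' : matrixI v w 0 0 = 0 := by rw [hw]; rfl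
  obtain ⟨a, b⟩ := v
  have h01 : a 0 * (z ^ 4 - 1) = 0 := e 0 1
  have h02 : a 1 * z ^ 2 * (z ^ 4 - 1) = 0 := e 0 2
  have h12 : (a 0 + a 2 * z ^ 2) * (z ^ 4 - 1) = 0 := e 1 2
  have h20 : b 1 * (z ^ 4 - 1) = 0 := e 2 0
  have h21 : b 0 * z ^ 2 * (z ^ 4 - 1) = 0 := e 2 1
  have h10 : (b 2 + b 0 * z ^ 2) * (z ^ 4 - 1) = 0 := e 1 0
  have h00 : b 3 + (a 4 - a 3) * z ^ 2 - b 4 * z ^ 4 = 0 := e 0 0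
  have h11 : (a 4 - a 3) * z ^ 2 - (b 4 - b 3) * z ^ 4 = 0 := e 1 1
  have h22 : a 4 * z ^ 2 - (b 4 - b 3) * z ^ 4 - a 3 * z ^ 6 = 0 := e 2 2
  have h00' : b 3 + (a 4 - a 3) * w ^ 2 - b 4 * w ^ 4 = 0 := e'
  have hz01 := mul_ne_zero hz0 hz1
  have a0 : a 0 = 0 := mul_left_cancel₀ hz1 (by linear_combination h01)
  have a1 : a 1 = 0 := mul_left_cancel₀ hz01 (by linear_combination h02)
  have a2 : a 2 = 0 := mul_left_cancel₀ hz01 (by linear_combination h12 - h01)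
  have a3 : a 3 = 0 := mul_left_cancel₀ hz01 (by linear_combination h11 - h22)
  have b1 : b 1 = 0 := mul_left_cancel₀ hz1 (by linear_combination h20)
  have b0 : b 0 = 0 := mul_left_cancel₀ hz01 (by linear_combination h21)
  have b2 : b 2 = 0 := mul_left_cancel₀ hz1 (by linear_combination h10 - h21)
  have b3 : b 3 = 0 := mul_left_cancel₀ hz1 (by linear_combination h11 - h00)
  have b4 : b 4 = 0 := by
    refine mul_left_cancel₀ (mul_ne_zero (mul_ne_zero hz0 hw0) (sub_ne_zero.2 hzw)) ?_
    linear_combination w ^ 2 * h00 - z ^ 2 * h00' + (z ^ 2 - w ^ 2) * b3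
  have a4 : a 4 = 0 := mul_left_cancel₀ hz0 (by
    linear_combination h00 - b3 + z ^ 2 * a3 + z ^ 4 * b4)
  refine hv (Prod.ext (funext fun i => ?_) (funext fun i => ?_)) <;> fin_cases i <;> assumption

/-- A nonzero coordinate vector gives a matrix `K_II` that is not identically zero. -/
theorem not_meroEq_matrixII (hD : IsOpen D) (hD' : IsConnected D) {v : CoordII} (hv : v ≠ 0) :
    ¬ MeroEq D (matrixII v) 0 := by
  intro h
  have hl := codiscreteWithin_neBot hD hD'.nonempty
  obtain ⟨z, hz, hz0, hz1⟩ := (h.and (eventually_generic D)).exists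
  have e : ∀ i j, matrixII v z i j = 0 := fun i j => by rw [hz]; rfl
  obtain ⟨b, c⟩ := v
  have h02 : c 0 * (z ^ 4 - 1) = 0 := e 0 2
  have h12 : c 2 * (z ^ 4 - 1) = 0 := e 1 2
  have h20 : c 1 * (z ^ 4 - 1) = 0 := e 2 0
  have h10 : -c 5 * (z ^ 4 - 1) = 0 := e 1 0
  have h00 : c 3 - c 4 + b * z ^ 2 = 0 := e 0 0
  have h11 : -c 4 + b * z ^ 2 + c 3 * z ^ 4 = 0 := e 1 1
  have h22 : b * z ^ 2 + (c 3 - c 4) * z ^ 4 = 0 := e 2 2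
  have c0 : c 0 = 0 := mul_left_cancel₀ hz1 (by linear_combination h02)
  have c1 : c 1 = 0 := mul_left_cancel₀ hz1 (by linear_combination h20)
  have c2 : c 2 = 0 := mul_left_cancel₀ hz1 (by linear_combination h12)
  have c3 : c 3 = 0 := mul_left_cancel₀ hz1 (by linear_combination h11 - h00)
  have c4 : c 4 = 0 := mul_left_cancel₀ hz1 (by linear_combination h11 - h22)
  have c5 : c 5 = 0 := mul_left_cancel₀ hz1 (by linear_combination -h10)
  have hb : b = 0 := mul_left_cancel₀ hz0 (by linear_combination h00 - c3 + c4)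
  refine hv (Prod.ext hb (funext fun i => ?_))
  fin_cases i <;> assumption

theorem mem_solutionSpace_of_eqUpToFactor (hD' : IsConnected D) (hq : q ≠ 0) (hq1 : q ^ 2 ≠ 1)
    {L : ℂ → Mat3} (hK : K ∈ meroMatrices D) (hL : ¬ MeroEq D L 0) (h : EqUpToFactor D K L)
    (hP : ∀ z w t : ℂ, z ≠ 0 → w ≠ 0 → PolyReflection (z ^ 2) (w ^ 2) t (L z) (L w)) :
    K ∈ solutionSpace q D := by
  obtain ⟨f, hf, hf0, hKL⟩ := h
  have hf0 := (eventually_eq_zero_or_ne_zero hD' hf).resolve_left hf0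
  refine ⟨hK, fun hK0 => hL ?_, (reflectionEquation_iff hq hq1).2 ?_⟩
  · filter_upwards [hK0, hKL, hf0] with z h0 hz hfz
    exact (smul_eq_zero.1 (hz.symm.trans h0)).resolve_left hfz
  · have hne : ∀ z : ℂ, z ^ 2 ≠ 0 → z ≠ 0 := fun z hz => (pow_ne_zero_iff two_ne_zero).1 hz
    filter_upwards [hKL, eventually_sq_ne 0] with z hz hz0
    filter_upwards [hKL, eventually_sq_ne 0] with w hw hw0
    rw [hz, hw]
    exact smul_polyReflection (hP z w _ (hne z hz0) (hne w hw0)) _ _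

theorem subset_solutionSpace (hD : IsOpen D) (hD' : IsConnected D) (hq : q ≠ 0)
    (hq1 : q ^ 2 ≠ 1) : spaceI D ∪ spaceII D ⊆ solutionSpace q D := by
  rintro K (⟨hK, Q, hQ, h⟩ | ⟨hK, Q, hQ, h⟩)
  · refine mem_solutionSpace_of_eqUpToFactor hD' hq hq1 hK
      (not_meroEq_matrixI hD hD' Q.rep_nonzero) h fun z w t _ _ => ?_
    rw [← toMatrix_coordsI, ← toMatrix_coordsI]
    exact (exchange_coordsI hQ _ _).polyReflection t
  · refine mem_solutionSpace_of_eqUpToFactor hD' hq hq1 hK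
      (not_meroEq_matrixII hD hD' Q.rep_nonzero) h fun z w t hz hw => ?_
    rw [← toMatrix_coordsII _ hz, ← toMatrix_coordsII _ hw]
    exact (exchange_coordsII hQ (pow_ne_zero 2 hz) (pow_ne_zero 2 hw)).polyReflection t

theorem solutionSpace_eq (hD : IsOpen D) (hD' : IsConnected D) (hq : q ≠ 0) (hq1 : q ^ 2 ≠ 1) :
    solutionSpace q D = spaceI D ∪ spaceII D :=
  (solutionSpace_subset hD hD' hq hq1).antisymm (subset_solutionSpace hD hD' hq hq1)

end SolutionSpace
end CremmerGervais

theorem mainTheorem2 (D : Set ℂ) (hD : IsOpen D) (hD' : IsConnected D) :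
    (∀ q : ℂ, q ≠ 0 → q ^ 2 ≠ 1 →
      CremmerGervais.solutionSpace q D =
        CremmerGervais.spaceI D ∪ CremmerGervais.spaceII D) ∧
    (∀ q q' : ℂ, q ≠ 0 → q ^ 2 ≠ 1 → q' ≠ 0 → q' ^ 2 ≠ 1 →
      CremmerGervais.solutionSpace q D = CremmerGervais.solutionSpace q' D) :=
  ⟨fun _ hq hq1 => CremmerGervais.solutionSpace_eq hD hD' hq hq1, fun _ _ hq hq1 hq' hq1' =>
    (CremmerGervais.solutionSpace_eq hD hD' hq hq1).trans
      (CremmerGervais.solutionSpace_eq hD hD' hq' hq1').symm⟩
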